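/- Consider a server with $R$ resource types of capacities $P_1,\dots,P_R$ and $K$ types of jobs. A type-$i$ job demands $D_{ij}\ge 0$ units of resource $j$, type-$i$ jobs arrive as a Poisson process of rate $\lambda_i\ge 0$, and their service requirements are exponential with rate $\mu_i>0$; let $\Lambda=\sum_i\lambda_i>0$. A preemptive Markovian service rate (pMSR) policy $p$ is an autonomous irreducible finite-state continuous-time Markov chain $m$ (the modulating process) with generator $G$, together with, for each state $s$, a schedule $(u_{s,1},\dots,u_{s,K})\in\mathbb{Z}_{\ge0}^K$ with $\sum_i u_{s,i}D_{ij}\le P_j$ for all $j$: while $m$ is in state $s$ and there are $q_i$ type-$i$ jobs present, $\min(u_{s,i},q_i)$ of them are served. For $\alpha>0$, $p(\alpha)$ is the policy with the same schedules and generator $\alpha G$. Write $r_i(s)=\mu_iu_{s,i}$, let $\pi$ be the stationary distribution of the modulating process, $\bar r_i=\sum_s\pi_sr_i(s)$, $\rho_i=\lambda_i/\bar r_i$, $\beta_i=\max_su_{s,i}$. Let $C_i(t)$ count the potential type-$i$ completions up to time $t$, i.e. events occurring at rate $r_i(s)$ while $m$ is in state $s$. The relative completions of state $s$ are $$\Delta_i(s)=\lim_{t\to\infty}\bigl(\mathbb{E}[C_i(t)\mid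 m(0)=s]-\bar r_i t\bigr),$$ and $\nu_i$ is the random state with $P(\nu_i=s)=\pi_sr_i(s)/\bar r_i$. The mean queue-length upper bounds for type $i$ and overall are $$U_i=\frac{\rho_i+\mathbb{E}[\Delta_i(\nu_i)]}{1-\rho_i}-\min_s\Delta_i(s)+\beta_i,\qquad U=\frac1\Lambda\sum_{i=1}^K\lambda_iU_i .$$ Quantities belonging to $p(\alpha)$ carry the argument $\alpha$. **Theorem.** Let $p$ be a pMSR policy with two modulating states, $G=\begin{pmatrix}-x_1&x_1\\x_2&-x_2\end{pmatrix}$, and suppose $\lambda_i<\bar r_i$ for all $i$. Then: 1. For every $\alpha>0$ the unique stationary distribution of the modulating process of $p(\alpha)$ is $\bigl(\frac{x_2}{x_1+x_2},\frac{x_1}{x_1+x_2}\bigr)$, and $\bar r_i=\frac{x_2r_i(1)+x_1r_i(2)}{x_1+x_2}$ and $\rho_i$ do not depend on $\alpha$. 2. For every $\alpha>0$ and $i$ the limits defining the relative completions exist, and $$\Delta_i(1)(\alpha)=\frac1\alpha\cdot\frac{x_1\,(r_i(1)-r_i(2))}{(x_1+x_2)^2},\qquad \Delta_i(2)(\alpha)=\frac1\alpha\cdot\frac{x_2\,(r_i(2)-r_i(1))}{(x_1+x_2)^2}.$$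 3. For every $\alpha>0$ and $i$, $$U_i(\alpha)=\frac{\rho_i}{1-\rho_i}+\frac{x_1x_2(r_i(1)-r_i(2))^2}{\alpha\,\bar r_i(1-\rho_i)(x_1+x_2)^3}+\frac{\max\{x_2(r_i(1)-r_i(2)),\,x_1(r_i(2)-r_i(1))\}}{\alpha(x_1+x_2)^2}+\beta_i .$$ 4. For every $\alpha>0$ and every stationary distribution of the Markov chain $(m,Q_1,\dots,Q_K)$ of modulating state and queue lengths under $p(\alpha)$, every $\mathbb{E}[Q_i]$ is finite, $\mathbb{E}[Q_i]\le U_i(\alpha)$, and $\mathbb{E}[Q]=\frac1\Lambda\sum_i\lambda_i\mathbb{E}[Q_i]\le U(\alpha)$. 5. For every $i$, $\alpha\mapsto U_i(\alpha)$ is non-increasing on $(0,\infty)$, and strictly decreasing if $u_{1,i}\ne u_{2,i}$; as $\alpha\to\infty$ it converges to its infimum over $\alpha>0$, which is $\frac{\rho_i}{1-\rho_i}+\beta_i$. 6. Likewise $\alpha\mapsto U(\alpha)$ is non-increasing on $(0,\infty)$, strictly decreasing if $u_{1,i}\ne u_{2,i}$ for some $i$ with $\lambda_i>0$, and as $\alpha\to\infty$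 it converges to its infimum $\frac1\Lambda\sum_i\lambda_i\bigl(\frac{\rho_i}{1-\rho_i}+\beta_i\bigr)$. That is, switching infinitely fast ($\alpha\to\infty$) minimizes the upper bounds. -/

import Mathlib

/-- A single server with `R` resource types, serving `K` types of multiresource jobs: a type-`i` job
demands `demand i j` of resource `j`, type-`i` jobs arrive as a Poisson process of rate `lam i`, and
their service requirements are exponential of rate `mu i`. -/
structure MultiresourceSystem (K R : ℕ) where
  demand : Fin K → Fin R → ℝ
  capacity : Fin R → ℝ
  lam : Fin K → ℝ
  mu : Fin K → ℝ
  demand_nonneg : ∀ i j, 0 ≤ demand i j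
  lam_nonneg : ∀ i, 0 ≤ lam i
  mu_pos : ∀ i, 0 < mu i

namespace MultiresourceSystem

variable {K R : ℕ}

/-- The schedulable set: `u i` jobs of each type `i` fit on the server together. -/
def schedulable (S : MultiresourceSystem K R) : Set (Fin K → ℕ) :=
  {u | ∀ j, ∑ i, (u i : ℝ) * S.demand i j ≤ S.capacity j}

/-- The total arrival rate. -/
def totalRate (S : MultiresourceSystem K R) : ℝ := ∑ i, S.lam i

/-- The arrival-weighted average `(1/Λ) ⟨λ, v⟩` of a vector indexed by job types. -/
noncomputable def average (S : MultiresourceSystem K R) (v : Fin K → ℝ) : ℝ :=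
  (1 / S.totalRate) * ∑ i, S.lam i * v i

end MultiresourceSystem

/-- `G` is the infinitesimal generator of an irreducible continuous-time Markov chain. -/
structure IsIrreducibleGenerator {N : ℕ} (G : Matrix (Fin N) (Fin N) ℝ) : Prop where
  off_diag_nonneg : ∀ s s', s ≠ s' → 0 ≤ G s s'
  row_sum : ∀ s, ∑ s', G s s' = 0
  irreducible : ∀ s s', Relation.ReflTransGen (fun a b => a ≠ b ∧ 0 < G a b) s s'

/-- `w` is a stationary distribution of the Markov chain with generator `G`. -/
structure IsStationaryDistribution {N : ℕ} (G : Matrix (Fin N) (Fin N) ℝ) (w : Fin N → ℝ) :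
    Prop where
  nonneg : ∀ s, 0 ≤ w s
  sum_eq_one : ∑ s, w s = 1
  balance : Matrix.vecMul w G = 0

/-- The stationary distribution (unique when `G` is an irreducible generator). -/
noncomputable def stationaryDistribution {N : ℕ} (G : Matrix (Fin N) (Fin N) ℝ) : Fin N → ℝ :=
  Classical.epsilon (IsStationaryDistribution G)

/-- The law of a counting process whose intensity is `r s` while a Markov chain with generator `G`
is in state `s` (the chain itself being unaffected by the count). The entry `(s, s')` of
`countProb G r n t` is the probability that, started in `s`, exactly `n` events occur during `[0, t]`
and the chain is in `s'` at time `t`.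
No event at all: the chain is killed at rate `r`, which gives the sub-Markovian semigroup of
`G - diag r`. For `n + 1` events: condition on the time `τ` of the last one. -/
noncomputable def countProb {N : ℕ} (G : Matrix (Fin N) (Fin N) ℝ) (r : Fin N → ℝ) :
    ℕ → ℝ → Matrix (Fin N) (Fin N) ℝ
  | 0, t => NormedSpace.exp (t • (G - Matrix.diagonal r))
  | n + 1, t => Matrix.of fun s s' => ∫ τ in (0 : ℝ)..t,
      (countProb G r n τ * Matrix.diagonal r *
        NormedSpace.exp ((t - τ) • (G - Matrix.diagonal r))) s s'

/-- The mean number of events during `[0, t]` when the chain starts in state `s`. -/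
noncomputable def meanCount {N : ℕ} (G : Matrix (Fin N) (Fin N) ℝ) (r : Fin N → ℝ)
    (s : Fin N) (t : ℝ) : ℝ :=
  ∑' n : ℕ, (n : ℝ) * ∑ s', countProb G r n t s s'

/-- A Markovian service rate policy for fully preemptible jobs, with `N` modulating states: an
autonomous irreducible Markov chain with generator `gen`, and a possible schedule `sched s` for each
of its states `s`. With no preemption overhead no further restriction is placed on the chain. -/
structure PMSRPolicy {K R : ℕ} (S : MultiresourceSystem K R) (N : ℕ) where
  gen : Matrix (Fin N) (Fin N) ℝ
  sched : Fin N → Fin K → ℕ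
  isGenerator : IsIrreducibleGenerator gen
  sched_mem : ∀ s, sched s ∈ S.schedulable

namespace PMSRPolicy

variable {K R N : ℕ} {S : MultiresourceSystem K R}

/-- The policy `p(α)`: the same schedules, and the generator scaled by the switching rate `α > 0`. -/
def scale (p : PMSRPolicy S N) (α : Set.Ioi (0 : ℝ)) : PMSRPolicy S N where
  gen := (α : ℝ) • p.gen
  sched := p.sched
  isGenerator :=
    { off_diag_nonneg := fun s s' h => by
        have hα : (0 : ℝ) < α := α.2
        simpa using mul_nonneg hα.le (p.isGenerator.off_diag_nonneg s s' h)
      row_sum := fun s => by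
        simp [← Finset.mul_sum, p.isGenerator.row_sum s]
      irreducible := fun s s' => by
        have hα : (0 : ℝ) < α := α.2
        refine Relation.ReflTransGen.mono (fun a b h => ⟨h.1, ?_⟩) s s' (p.isGenerator.irreducible s s')
        simpa using mul_pos hα h.2 }
  sched_mem := p.sched_mem

/-- The completion rate of type-`i` jobs in modulating state `s` of the corresponding single-server
(MSR-1) system. -/
def rate (p : PMSRPolicy S N) (i : Fin K) (s : Fin N) : ℝ := S.mu i * (p.sched s i : ℝ)

/-- The steady-state mean completion rate of type-`i` jobs in the MSR-1 system. -/
noncomputable def meanRate (p : PMSRPolicy S N) (i : Fin K) : ℝ :=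
  ∑ s, stationaryDistribution p.gen s * p.rate i s

/-- The load of the decoupled type-`i` system. -/
noncomputable def load (p : PMSRPolicy S N) (i : Fin K) : ℝ := S.lam i / p.meanRate i

/-- `E[C_i(t) | m(0) = s] - E[u_i] t`, with `C_i(t)` the number of (potential) type-`i` completions
of the MSR-1 system during `[0, t]`. -/
noncomputable def excessCompletions (p : PMSRPolicy S N) (i : Fin K) (s : Fin N) (t : ℝ) : ℝ :=
  meanCount p.gen (p.rate i) s t - p.meanRate i * t

/-- The relative completions `Δ_i(s)` of state `s`: the limit of the excess as `t → ∞`. -/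
noncomputable def relCompletions (p : PMSRPolicy S N) (i : Fin K) (s : Fin N) : ℝ :=
  Filter.limUnder Filter.atTop (p.excessCompletions i s)

/-- The completion-rate-weighted stationary distribution (the law of `ν_i`). -/
noncomputable def weightedDistribution (p : PMSRPolicy S N) (i : Fin K) (s : Fin N) : ℝ :=
  stationaryDistribution p.gen s * (p.rate i s / p.meanRate i)

/-- `E[Δ_i(ν_i)]`. -/
noncomputable def meanRelCompletions (p : PMSRPolicy S N) (i : Fin K) : ℝ :=
  ∑ s, p.weightedDistribution i s * p.relCompletions i s

/-- `β_i`: the maximum number of type-`i` jobs served in parallel. -/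
def maxServed (p : PMSRPolicy S N) (i : Fin K) : ℕ :=
  Finset.univ.sup fun s => p.sched s i

/-- The upper bound
`(ρ_i + E[Δ_i(ν_i)]) / (1 - ρ_i) - min_s Δ_i(s) + β_i` on the mean type-`i` queue length. -/
noncomputable def queueUpperBound (p : PMSRPolicy S N) (i : Fin K) : ℝ :=
  (p.load i + p.meanRelCompletions i) / (1 - p.load i) - (⨅ s, p.relCompletions i s)
    + (p.maxServed i : ℝ)

/-- The resulting upper bound on the mean queue length `E[Q] = (1/Λ) ⟨λ, E[𝐐]⟩`. -/
noncomputable def meanQueueUpperBound (p : PMSRPolicy S N) : ℝ :=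
  S.average p.queueUpperBound

/-- The generator of the Markov chain of modulating state and queue lengths `(m(t), Q_1(t), …, Q_K(t))`
acting on a function `f`: changes of the modulating state, arrivals, and departures; in state `s`,
`min (sched s i) (q i)` type-`i` jobs are in service, each completing at rate `mu i`. -/
noncomputable def queueGenerator (p : PMSRPolicy S N) (f : Fin N × (Fin K → ℕ) → ℝ)
    (x : Fin N × (Fin K → ℕ)) : ℝ :=
  (∑ s', p.gen x.1 s' * (f (s', x.2) - f x))
    + (∑ i, S.lam i * (f (x.1, Function.update x.2 i (x.2 i + 1)) - f x))
    + ∑ i, S.mu i * (min (p.sched x.1 i) (x.2 i) : ℕ) *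
        (f (x.1, Function.update x.2 i (x.2 i - 1)) - f x)

/-- `P` is a steady-state distribution of the chain of modulating state and queue lengths. All
transition rates are bounded, so the generator is a bounded operator on bounded functions and this
is equivalent to the global balance equations (which are the cases where `f` is the indicator of a
state). -/
structure IsSteadyState (p : PMSRPolicy S N)
    (P : MeasureTheory.Measure (Fin N × (Fin K → ℕ))) : Prop where
  isProbability : MeasureTheory.IsProbabilityMeasure P
  stationary : ∀ f : Fin N × (Fin K → ℕ) → ℝ, (∃ c, ∀ x, |f x| ≤ c) →
    ∫ x, p.queueGenerator f x ∂P = 0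

end PMSRPolicy

/-! Everything rests on the Poisson equation `G h = c - r` for the modulating chain, with `r` the
completion rate of one job type and `c` its stationary mean.

For the counting process, Kolmogorov's forward equations show that the mean count plus `exp (t G) h`
grows at rate exactly `c`, so the excess over `c t` is `h - exp (t G) h`. With two states the
centred `h` is an eigenvector of `G` for `-(x₁ + x₂)`; the correction decays exponentially and the
relative completions are `h` itself.

For the queue, the test function `q ^ 2 / 2 - q h` has drift `-(c - λ) q` up to bounded terms: the
corrector `-q h` replaces the fluctuating rate by its mean. Stationarity is assumed only against
bounded functions, so the quadratic is truncated at level `n`. The boundary error lives on levels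
`n` and `n + 1`, and cannot stay large for all `n` since the masses of the levels are summable. This
gives a finite mean queue length; dominated convergence then gives the exact drift identity, and the
waste inequality `mul_rate_sub_departureRate_le` turns it into the bound
(`integral_queueLength_le`).

Finally, `h` is homogeneous of degree `-1` in `G` and stationary means are of degree `0`, so each
bound has the form `a + b / α` with `b ≥ 0`, from which monotonicity, limit and infimum are
immediate. -/

/-! ### Counting processes modulated by a Markov chain: forward equations and mean count. -/

section CountingProcess

open NormedSpace MeasureTheory Set
open scoped Matrix.Norms.Operator

variable {N : ℕ} (G : Matrix (Fin N) (Fin N) ℝ) (r : Fin N → ℝ)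

theorem countProb_zero_apply (t : ℝ) :
    countProb G r 0 t = exp (t • (G - Matrix.diagonal r)) := rfl

theorem exp_neg_smul_mul_exp_smul (A : Matrix (Fin N) (Fin N) ℝ) (t : ℝ) :
    exp ((-t) • A) * exp (t • A) = 1 := by
  rw [← Matrix.exp_add_of_commute _ _ (((Commute.refl A).smul_left _).smul_right _), ← add_smul,
    neg_add_cancel, zero_smul, exp_zero]

/-- The variation-of-constants form of the recursion for `countProb`. -/
theorem countProb_succ_of_continuous {n : ℕ} (hn : Continuous (countProb G r n)) (t : ℝ) :
    countProb G r (n + 1) t =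
      (∫ τ in (0 : ℝ)..t, countProb G r n τ * Matrix.diagonal r *
        exp ((-τ) • (G - Matrix.diagonal r))) * exp (t • (G - Matrix.diagonal r)) := by
  set A := G - Matrix.diagonal r with hA
  have hexp : Continuous fun τ : ℝ => exp ((-τ) • A) :=
    (exp_continuous (𝔸 := Matrix (Fin N) (Fin N) ℝ)).comp (by fun_prop)
  have hcont : Continuous fun τ : ℝ =>
      countProb G r n τ * Matrix.diagonal r * exp ((-τ) • A) :=
    (hn.mul continuous_const).mul hexp
  ext s s'
  -- The recursion integrates entry by entry, while the claim has a matrix-valued integral. A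
  -- continuous linear functional, right multiplication followed by taking an entry, commutes with
  -- the integral.
  let L : Matrix (Fin N) (Fin N) ℝ →ₗ[ℝ] ℝ :=
    { toFun := fun M => (M * exp (t • A)) s s'
      map_add' := fun M M' => by simp [add_mul]
      map_smul' := fun c M => by simp }
  have hL := (LinearMap.toContinuousLinearMap L).intervalIntegral_comp_comm
    (hcont.intervalIntegrable (μ := volume) 0 t)
  have hLa : ∀ M, LinearMap.toContinuousLinearMap L M = (M * exp (t • A)) s s' := fun M => rfl
  refine Eq.trans ?_ hL
  change ∫ τ in (0 : ℝ)..t, (countProb G r n τ * Matrix.diagonal r * exp ((t - τ) • A)) s s' = _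
  congr 1
  ext τ
  have h1 : (t - τ) • A = (-τ) • A + t • A := by rw [← add_smul]; congr 1; ring
  have h2 : countProb G r n τ * Matrix.diagonal r * exp ((t - τ) • A) =
      countProb G r n τ * Matrix.diagonal r * exp ((-τ) • A) * exp (t • A) := by
    rw [h1, Matrix.exp_add_of_commute _ _ (((Commute.refl A).smul_left _).smul_right _),
      mul_assoc _ _ (exp (t • A))]
  exact congrFun (congrFun h2 s) s'

theorem continuous_countProb (n : ℕ) : Continuous (countProb G r n) := by
  have hexp : Continuous fun τ : ℝ => exp (τ • (G - Matrix.diagonal r)) :=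
    (exp_continuous (𝔸 := Matrix (Fin N) (Fin N) ℝ)).comp (by fun_prop)
  induction n with
  | zero => exact hexp
  | succ n ih =>
    have hcont : Continuous fun τ : ℝ =>
        countProb G r n τ * Matrix.diagonal r * exp ((-τ) • (G - Matrix.diagonal r)) :=
      (ih.mul continuous_const).mul (hexp.comp continuous_neg)
    rw [funext (countProb_succ_of_continuous G r ih)]
    exact (intervalIntegral.continuous_primitive (fun a b => hcont.intervalIntegrable a b) 0).mul
      hexp

/-- The time derivative of `countProb`, as given by the Kolmogorov forward equations. -/
noncomputable def countProbDeriv : ℕ → ℝ → Matrix (Fin N) (Fin N) ℝ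
  | 0, t => countProb G r 0 t * (G - Matrix.diagonal r)
  | n + 1, t => countProb G r n t * Matrix.diagonal r +
      countProb G r (n + 1) t * (G - Matrix.diagonal r)

/-- In variation-of-constants form the variable `t` no longer occurs in the integrand, so the
product rule applies; in the source term `exp (-t A) * exp (t A)` cancels. -/
theorem hasDerivAt_countProb (n : ℕ) (t : ℝ) :
    HasDerivAt (countProb G r n) (countProbDeriv G r n t) t := by
  have hexp := hasDerivAt_exp_smul_const (𝕂 := ℝ) (G - Matrix.diagonal r) t
  cases n with
  | zero => exact hexp
  | succ n =>
    have ih := continuous_countProb G r n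
    have hcont : Continuous fun τ : ℝ =>
        countProb G r n τ * Matrix.diagonal r * exp ((-τ) • (G - Matrix.diagonal r)) :=
      (ih.mul continuous_const).mul
        ((exp_continuous (𝔸 := Matrix (Fin N) (Fin N) ℝ)).comp (by fun_prop))
    have : TopologicalSpace.PseudoMetrizableSpace (Matrix (Fin N) (Fin N) ℝ) :=
      inferInstanceAs (TopologicalSpace.PseudoMetrizableSpace (Fin N → Fin N → ℝ))
    have h := (intervalIntegral.integral_hasDerivAt_right (hcont.intervalIntegrable 0 t)
      (hcont.stronglyMeasurableAtFilter _ _) hcont.continuousAt).mul hexp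
    rw [funext (countProb_succ_of_continuous G r ih)]
    refine h.congr_deriv (Eq.symm ?_)
    change countProb G r n t * Matrix.diagonal r +
      countProb G r (n + 1) t * (G - Matrix.diagonal r) = _
    rw [countProb_succ_of_continuous G r ih]
    change _ = countProb G r n t * Matrix.diagonal r * exp ((-t) • (G - Matrix.diagonal r)) *
      exp (t • (G - Matrix.diagonal r)) + _ * (exp (t • (G - Matrix.diagonal r)) * _)
    rw [mul_assoc _ (exp _) (exp _), exp_neg_smul_mul_exp_smul, mul_one, mul_assoc _ (exp _) _]

/-- Factorial decay of `countProb` in the number of events, locally uniformly in time. -/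
theorem exists_norm_countProb_le (T : ℝ) : ∃ K c : ℝ, 0 ≤ K ∧ 0 ≤ c ∧ ∀ n t, |t| ≤ T →
    ‖countProb G r n t‖ ≤ K * (c ^ n * |t| ^ n / n.factorial) := by
  have hexp : Continuous fun τ : ℝ => exp (τ • (G - Matrix.diagonal r)) :=
    (exp_continuous (𝔸 := Matrix (Fin N) (Fin N) ℝ)).comp (by fun_prop)
  obtain ⟨K, hK⟩ := (isCompact_Icc (a := -T) (b := T)).exists_bound_of_continuousOn
    hexp.continuousOn
  have hK' : ∀ t, |t| ≤ T → ‖exp (t • (G - Matrix.diagonal r))‖ ≤ |K| := fun t ht =>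
    (hK t (abs_le.1 ht)).trans (le_abs_self K)
  set d := ‖Matrix.diagonal r‖
  have hd : 0 ≤ d := norm_nonneg _
  -- Each further event costs one factor `diagonal r` and the two exponentials at `-τ` and `t`, both
  -- bounded by `|K|` on `[-T, T]`; integrating the power of `|τ|` produces the factorial.
  refine ⟨|K|, d * |K| * |K|, abs_nonneg _, by positivity, fun n => ?_⟩
  induction n with
  | zero => intro t ht; simpa [countProb_zero_apply] using hK' t ht
  | succ n ih =>
    intro t ht
    have hsub : ∀ τ ∈ uIoc 0 t, |τ| ≤ |t| := by
      intro τ hτ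
      rcases le_total 0 t with h | h
      · rw [uIoc_of_le h] at hτ
        rw [abs_of_pos hτ.1, abs_of_nonneg h]; exact hτ.2
      · rw [uIoc_of_ge h] at hτ
        rw [abs_of_nonpos hτ.2, abs_of_nonpos h]; linarith [hτ.1]
    have hint : IntegrableOn (fun τ : ℝ => |K| * ((d * |K| * |K|) ^ n * |τ - 0| ^ n / n.factorial)
        * d * |K|) (uIoc 0 t) := by
      have : Continuous (fun τ : ℝ => |K| * ((d * |K| * |K|) ^ n * |τ - 0| ^ n / n.factorial)
        * d * |K|) := by fun_prop
      exact (this.intervalIntegrable 0 t).def'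
    have hW : ‖∫ τ in (0 : ℝ)..t, countProb G r n τ * Matrix.diagonal r *
        exp ((-τ) • (G - Matrix.diagonal r))‖ ≤
        |K| * ((d * |K| * |K|) ^ n * (|t| ^ (n + 1) / (n + 1)) / n.factorial) * d * |K| := by
      rw [intervalIntegral.norm_integral_eq_norm_integral_uIoc]
      refine (norm_integral_le_of_norm_le hint ?_).trans_eq ?_
      · filter_upwards [ae_restrict_mem measurableSet_uIoc] with τ hτ
        have h1 := (hsub τ hτ).trans ht
        refine (norm_mul_le _ _).trans (mul_le_mul ((norm_mul_le _ _).trans ?_)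
          (hK' _ (by rwa [abs_neg])) (norm_nonneg _) (by positivity))
        rw [sub_zero]; exact mul_le_mul_of_nonneg_right (ih τ h1) hd
      · rw [integral_mul_const, integral_mul_const, integral_const_mul, integral_div,
          integral_const_mul, integral_pow_abs_sub_uIoc, sub_zero]
    rw [countProb_succ_of_continuous G r (continuous_countProb G r n)]
    refine (norm_mul_le _ _).trans ((mul_le_mul hW (hK' t ht) (norm_nonneg _)
      (by positivity)).trans_eq ?_)
    rw [Nat.factorial_succ]
    push_cast
    field_simp
    ring

variable {a : ℕ → ℝ} {C : ℝ}

theorem summable_countProb_bound (K c T : ℝ) :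
    Summable fun n : ℕ => C * 2 ^ n * (K * (c ^ n * T ^ n / n.factorial)) := by
  refine ((Real.summable_pow_div_factorial (2 * c * T)).mul_left (C * K)).congr fun n => ?_
  rw [mul_pow, mul_pow]; ring

/-- Weights of size `2 ^ n` are harmless against factorial decay, and they cover the two cases
needed: `1` (total mass) and `n` (mean count). -/
theorem summable_smul_countProb (ha : ∀ n, |a n| ≤ C * 2 ^ n) (t : ℝ) :
    Summable fun n => a n • countProb G r n t := by
  obtain ⟨K, c, hK, hc, hb⟩ := exists_norm_countProb_le G r |t|
  refine .of_norm_bounded (summable_countProb_bound (C := C) K c |t|) fun n => ?_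
  rw [norm_smul]
  exact mul_le_mul (ha n) (hb n t le_rfl) (norm_nonneg _) ((abs_nonneg _).trans (ha n))

/-- Termwise differentiation of the forward equations. An event raises the count from `n` to `n +
1`, so the `diagonal r` part carries the shifted weights. -/
theorem hasDerivAt_tsum_smul_countProb (ha : ∀ n, |a n| ≤ C * 2 ^ n) (t : ℝ) :
    HasDerivAt (fun t => ∑' n, a n • countProb G r n t)
      ((∑' n, a n • countProb G r n t) * (G - Matrix.diagonal r) +
        (∑' n, a (n + 1) • countProb G r n t) * Matrix.diagonal r) t := by
  set A := G - Matrix.diagonal r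
  set T := |t| + 1
  obtain ⟨K, c, hK, hc, hb⟩ := exists_norm_countProb_le G r T
  have hC : 0 ≤ C := by simpa using (abs_nonneg _).trans (ha 0)
  have hT : 0 ≤ T := by positivity
  have ha' : ∀ n, |a (n + 1)| ≤ 2 * C * 2 ^ n := fun n => (ha (n + 1)).trans_eq (by ring)
  have hsA := (summable_smul_countProb G r ha t).mul_right A
  have hsD := (summable_smul_countProb G r ha' t).mul_right (Matrix.diagonal r)
  have hb' : ∀ n y, y ∈ Ioo (-T) T → ‖countProb G r n y‖ ≤ K * (c ^ n * T ^ n / n.factorial) := by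
    intro n y hy
    have hy' : |y| ≤ T := abs_le.2 ⟨hy.1.le, hy.2.le⟩
    refine (hb n y hy').trans ?_
    gcongr
  -- A summable majorant of the derivatives on `(-T, T)`, split like `countProbDeriv`: count `0` has
  -- no inflow.
  let u : ℕ → ℝ := fun n => match n with
    | 0 => C * 2 ^ 0 * (K * (c ^ 0 * T ^ 0 / Nat.factorial 0)) * ‖A‖
    | n + 1 => 2 * C * 2 ^ n * (K * (c ^ n * T ^ n / n.factorial)) * ‖Matrix.diagonal r‖ +
        C * 2 ^ (n + 1) * (K * (c ^ (n + 1) * T ^ (n + 1) / (n + 1).factorial)) * ‖A‖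
  have hu : Summable u := by
    refine (summable_nat_add_iff 1).1 ?_
    exact ((summable_countProb_bound K c T).mul_right _).add
      (((summable_nat_add_iff 1).2 (summable_countProb_bound (C := C) K c T)).mul_right _)
  have hder := hasDerivAt_tsum_of_isPreconnected (𝕜 := ℝ) (t := Ioo (-T) T) (y := t) (y₀ := t)
    (g := fun n t => a n • countProb G r n t) (g' := fun n t => a n • countProbDeriv G r n t)
    hu isOpen_Ioo isPreconnected_Ioo (fun n y _ => (hasDerivAt_countProb G r n y).fun_const_smul _)
    (fun n y hy => ?_) (abs_lt.1 (by simp [T])) (summable_smul_countProb G r ha t)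
    (abs_lt.1 (by simp [T]))
  · refine hder.congr_deriv (Eq.symm ?_)
    have h0 := (summable_smul_countProb G r ha t).tsum_mul_right A
    have hA := (summable_nat_add_iff 1).2 hsA
    have hg : Summable fun n => a n • countProbDeriv G r n t := by
      refine (summable_nat_add_iff 1).1 ((hsD.add hA).congr fun n => ?_)
      change _ = a (n + 1) • (_ + _)
      rw [smul_add, smul_mul_assoc, smul_mul_assoc]
    rw [← h0, ← (summable_smul_countProb G r ha' t).tsum_mul_right]
    have hsum : ∑' n, a n • countProbDeriv G r n t = _ := hg.tsum_eq_zero_add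
    refine Eq.trans ?_ hsum.symm
    rw [hsA.tsum_eq_zero_add, add_assoc, ← hA.tsum_add hsD]
    congr 1
    · exact smul_mul_assoc _ _ _
    · refine tsum_congr fun n => ?_
      change _ = a (n + 1) • (_ + _)
      rw [smul_add, smul_mul_assoc, smul_mul_assoc, add_comm]
  · have key : ∀ n B, |a n| ≤ B → ∀ (m : ℕ) (M : Matrix (Fin N) (Fin N) ℝ),
      ‖a n • (countProb G r m y * M)‖ ≤ B * (K * (c ^ m * T ^ m / m.factorial)) * ‖M‖ := by
      intro n B hB m M
      rw [norm_smul, mul_assoc]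
      exact mul_le_mul hB ((norm_mul_le _ _).trans
        (mul_le_mul_of_nonneg_right (hb' m y hy) (norm_nonneg _))) (norm_nonneg _)
        ((abs_nonneg _).trans hB)
    cases n with
    | zero => exact key 0 _ (ha 0) 0 A
    | succ n =>
      change ‖a (n + 1) • (_ + _)‖ ≤ _
      rw [smul_add]
      exact norm_add_le_of_le (key (n + 1) _ (ha' n) n _) (key (n + 1) _ (ha (n + 1)) (n + 1) A)

theorem tsum_smul_countProb_zero : ∑' n, a n • countProb G r n 0 = a 0 • 1 := by
  rw [tsum_eq_single 0]
  · simp [countProb_zero_apply]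
  · intro n hn
    obtain ⟨m, rfl⟩ := Nat.exists_eq_succ_of_ne_zero hn
    rw [Nat.succ_eq_add_one, countProb_succ_of_continuous G r (continuous_countProb G r m)]
    simp

/-- Forgetting the count recovers the transition semigroup of the chain. -/
theorem tsum_countProb (t : ℝ) : ∑' n, countProb G r n t = exp (t • G) := by
  have ha : ∀ n : ℕ, |(1 : ℝ)| ≤ 1 * 2 ^ n := fun n => by
    rw [abs_one, one_mul]; exact one_le_pow₀ one_le_two
  -- Constant weights are unchanged by the shift, so the killing and event terms cancel and the sum
  -- solves `S' = S G`. Multiplying by `exp (-t G)` gives a constant, which is uniqueness for this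
  -- linear equation.
  have hS : ∀ t, HasDerivAt (fun t => ∑' n, (1 : ℝ) • countProb G r n t)
      ((∑' n, (1 : ℝ) • countProb G r n t) * G) t := fun t => by
    have := hasDerivAt_tsum_smul_countProb G r ha t
    rwa [← mul_add, sub_add_cancel] at this
  have hprod : ∀ t, HasDerivAt
      (fun t : ℝ => (∑' n, (1 : ℝ) • countProb G r n t) * exp (t • (-G))) 0 t := fun t => by
    have := (hS t).mul (hasDerivAt_exp_smul_const' (𝕂 := ℝ) (-G) t)
    refine this.congr_deriv ?_
    rw [mul_assoc, ← mul_add, ← add_mul, add_neg_cancel, zero_mul, mul_zero]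
  have hconst := is_const_of_deriv_eq_zero (fun t => (hprod t).differentiableAt)
    (fun t => (hprod t).deriv) t 0
  rw [tsum_smul_countProb_zero G r (a := fun _ => 1), one_smul, zero_smul, exp_zero,
    mul_one] at hconst
  simp only [one_smul] at hconst
  have hinv : exp (t • (-G)) * exp (t • G) = 1 := by
    rw [smul_neg, ← neg_smul, exp_neg_smul_mul_exp_smul]
  rw [← mul_one (∑' n, _), ← hinv, ← mul_assoc, hconst, one_mul]

/-- The mean count, in terms of a solution `h` of the Poisson equation `G h = c - r`. -/
theorem meanCount_eq_of_poisson {c : ℝ} {h : Fin N → ℝ} (hG : G.mulVec 1 = 0)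
    (hh : ∀ s, G.mulVec h s = c - r s) (s : Fin N) (t : ℝ) :
    meanCount G r s t = c * t + h s - (exp (t • G)).mulVec h s := by
  have hn : ∀ n : ℕ, |(n : ℝ)| ≤ 1 * 2 ^ n := fun n => by
    rw [Nat.abs_cast, one_mul]; exact_mod_cast Nat.lt_two_pow_self.le
  have h1 : ∀ n : ℕ, |(1 : ℝ)| ≤ 1 * 2 ^ n := fun n => by
    rw [abs_one, one_mul]; exact one_le_pow₀ one_le_two
  have hexp1 : ∀ t : ℝ, (exp (t • G)).mulVec 1 = 1 := fun t => by
    have hd : ∀ t : ℝ, HasDerivAt (fun t : ℝ => (exp (t • G)).mulVec 1) 0 t := fun t => by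
      let L : Matrix (Fin N) (Fin N) ℝ →ₗ[ℝ] (Fin N → ℝ) :=
        { toFun := fun M => M.mulVec 1
          map_add' := fun M M' => Matrix.add_mulVec _ _ _
          map_smul' := fun c M => Matrix.smul_mulVec _ _ _ }
      have := (LinearMap.toContinuousLinearMap L).hasFDerivAt.comp_hasDerivAt t
        (hasDerivAt_exp_smul_const (𝕂 := ℝ) G t)
      refine this.congr_deriv ?_
      change (exp (t • G) * G).mulVec 1 = _
      rw [← Matrix.mulVec_mulVec, hG, Matrix.mulVec_zero]
    have := is_const_of_deriv_eq_zero (fun t => (hd t).differentiableAt) (fun t => (hd t).deriv) t 0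
    simpa using this
  let L : Matrix (Fin N) (Fin N) ℝ →ₗ[ℝ] ℝ :=
    { toFun := fun M => ∑ s', M s s'
      map_add' := fun M M' => by simp [Finset.sum_add_distrib]
      map_smul' := fun c M => by simp [Finset.mul_sum] }
  let Lh : Matrix (Fin N) (Fin N) ℝ →ₗ[ℝ] ℝ :=
    { toFun := fun M => M.mulVec h s
      map_add' := fun M M' => by simp [Matrix.add_mulVec]
      map_smul' := fun c M => by simp [Matrix.smul_mulVec] }
  have hL1 : ∀ M, L M = M.mulVec 1 s := fun M => by simp [L, Matrix.mulVec, dotProduct]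
  have hmean : ∀ t, meanCount G r s t = L (∑' n : ℕ, (n : ℝ) • countProb G r n t) := fun t => by
    have := (LinearMap.toContinuousLinearMap L).map_tsum (summable_smul_countProb G r hn t)
    exact (this.trans (tsum_congr fun n => map_smul _ _ _)).symm
  -- Shifting the weights `n` adds the weights `1`, whose sum is the semigroup.
  have hshift : ∀ t, ∑' n : ℕ, ((n + 1 : ℕ) : ℝ) • countProb G r n t =
      (∑' n : ℕ, (n : ℝ) • countProb G r n t) + exp (t • G) := fun t => by
    have hs1 := summable_smul_countProb G r h1 t
    rw [← tsum_countProb G r t, ← tsum_congr (fun n => one_smul ℝ (countProb G r n t)),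
      ← (summable_smul_countProb G r hn t).tsum_add hs1]
    exact tsum_congr fun n => by rw [Nat.cast_succ, add_smul]
  -- Since `G 1 = 0`, the mean count has derivative `exp (t G) r`. Adding `exp (t G) G h = exp (t G)
  -- (c - r)` leaves `c exp (t G) 1 = c`.
  have hder : ∀ t, HasDerivAt (fun t => meanCount G r s t + (exp (t • G)).mulVec h s - c * t)
      0 t := fun t => by
    have hM := (LinearMap.toContinuousLinearMap L).hasFDerivAt.comp_hasDerivAt t
      (hasDerivAt_tsum_smul_countProb G r hn t)
    have hE := (LinearMap.toContinuousLinearMap Lh).hasFDerivAt.comp_hasDerivAt t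
      (hasDerivAt_exp_smul_const (𝕂 := ℝ) G t)
    rw [funext hmean]
    refine ((hM.add hE).sub ((hasDerivAt_id t).const_mul c)).congr_deriv ?_
    rw [hshift t, add_mul, ← add_assoc, ← mul_add, sub_add_cancel]
    change L (_ * G + exp (t • G) * Matrix.diagonal r) + (exp (t • G) * G).mulVec h s - c * 1 = 0
    have hr : (Matrix.diagonal r).mulVec 1 + G.mulVec h = c • 1 := by
      ext s'
      simp [Matrix.mulVec_diagonal, hh]
    rw [hL1, Matrix.add_mulVec, ← Matrix.mulVec_mulVec, hG, Matrix.mulVec_zero, zero_add,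
      ← Matrix.mulVec_mulVec, ← Matrix.mulVec_mulVec, ← Pi.add_apply, ← Matrix.mulVec_add, hr,
      Matrix.mulVec_smul, hexp1]
    simp
  have hconst := is_const_of_deriv_eq_zero (fun t => (hder t).differentiableAt)
    (fun t => (hder t).deriv) t 0
  have h0 : meanCount G r s 0 = 0 := by
    rw [hmean, tsum_smul_countProb_zero G r (a := fun n => (n : ℝ))]
    simp
  simp only [h0, zero_smul, exp_zero, Matrix.one_mulVec] at hconst
  linarith

/-- The semigroup of a generator acts on an eigenvector of the generator by an exponential. -/
theorem exp_smul_mulVec_of_eigenvector {x : ℝ} {h : Fin N → ℝ}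
    (hG : G.mulVec h = x • h) (t : ℝ) :
    (exp (t • G)).mulVec h = Real.exp (x * t) • h := by
  let L : Matrix (Fin N) (Fin N) ℝ →ₗ[ℝ] (Fin N → ℝ) :=
    { toFun := fun M => M.mulVec h
      map_add' := fun M M' => Matrix.add_mulVec _ _ _
      map_smul' := fun c M => Matrix.smul_mulVec _ _ _ }
  have hd : ∀ t : ℝ, HasDerivAt (fun t : ℝ => Real.exp (-x * t) • (exp (t • G)).mulVec h) 0 t :=
    fun t => by
      have h1 := (LinearMap.toContinuousLinearMap L).hasFDerivAt.comp_hasDerivAt t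
        (hasDerivAt_exp_smul_const (𝕂 := ℝ) G t)
      have h2 := ((hasDerivAt_id t).const_mul (-x)).exp
      refine (h2.smul h1).congr_deriv ?_
      change Real.exp (-x * t) • (exp (t • G) * G).mulVec h +
        (Real.exp (-x * t) * (-x * 1)) • (exp (t • G)).mulVec h = 0
      rw [← Matrix.mulVec_mulVec, hG, Matrix.mulVec_smul, smul_smul, ← add_smul]
      simp
  have := is_const_of_deriv_eq_zero (fun t => (hd t).differentiableAt) (fun t => (hd t).deriv) t 0
  simp only [mul_zero, Real.exp_zero, zero_smul, exp_zero, Matrix.one_mulVec, one_smul] at this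
  conv_rhs => rw [← this, smul_smul, ← Real.exp_add]
  simp

end CountingProcess

/-! ### The single-type generator and the truncated quadratic Lyapunov function. -/

namespace PMSRPolicy

open MeasureTheory Filter Topology

variable {K R N : ℕ} {S : MultiresourceSystem K R} (p : PMSRPolicy S N) (i : Fin K)

/-- The total completion rate of type-`i` jobs in modulating state `s` with `q` of them present. -/
noncomputable def departureRate (s : Fin N) (q : ℕ) : ℝ := S.mu i * (min (p.sched s i) q : ℕ)

/-- The generator of the chain of modulating state and number of type-`i` jobs. -/
noncomputable def typeGenerator (g : Fin N → ℕ → ℝ) (s : Fin N) (q : ℕ) : ℝ :=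
  (∑ s', p.gen s s' * (g s' q - g s q)) + S.lam i * (g s (q + 1) - g s q)
    + p.departureRate i s q * (g s (q - 1) - g s q)

/-- The types decouple: the modulating chain is autonomous and events of another type leave
coordinate `i` unchanged. -/
theorem queueGenerator_comp (g : Fin N → ℕ → ℝ) (x : Fin N × (Fin K → ℕ)) :
    p.queueGenerator (fun x => g x.1 (x.2 i)) x = p.typeGenerator i g x.1 (x.2 i) := by
  rw [queueGenerator, typeGenerator, departureRate]
  congr 1
  · congr 1
    rw [Finset.sum_eq_single i]
    · simp
    · intro j _ hj
      simp [Function.update_of_ne hj.symm]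
    · simp
  · rw [Finset.sum_eq_single i]
    · simp
    · intro j _ hj
      simp [Function.update_of_ne hj.symm]
    · simp

theorem departureRate_nonneg (s : Fin N) (q : ℕ) : 0 ≤ p.departureRate i s q :=
  mul_nonneg (S.mu_pos i).le (Nat.cast_nonneg _)

theorem departureRate_le_rate (s : Fin N) (q : ℕ) : p.departureRate i s q ≤ p.rate i s :=
  mul_le_mul_of_nonneg_left (by exact_mod_cast min_le_left _ _) (S.mu_pos i).le

theorem sched_le_maxServed (s : Fin N) : p.sched s i ≤ p.maxServed i :=
  Finset.le_sup (f := fun s => p.sched s i) (Finset.mem_univ s)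

theorem rate_le (s : Fin N) : p.rate i s ≤ S.mu i * p.maxServed i :=
  mul_le_mul_of_nonneg_left (by exact_mod_cast p.sched_le_maxServed i s) (S.mu_pos i).le

/-- Service capacity is unused only while fewer than `maxServed` jobs are present. -/
theorem mul_rate_sub_departureRate_le (s : Fin N) (q : ℕ) (a : ℝ) :
    (q - a) * (p.rate i s - p.departureRate i s q) ≤
      (p.maxServed i - a) * (p.rate i s - p.departureRate i s q) := by
  rcases le_total (p.sched s i) q with h | h
  · simp [rate, departureRate, min_eq_left h]
  · refine mul_le_mul_of_nonneg_right ?_ (sub_nonneg.2 (p.departureRate_le_rate i s q))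
    have : (q : ℝ) ≤ p.maxServed i := by exact_mod_cast h.trans (p.sched_le_maxServed i s)
    linarith

theorem sum_gen_mul_sub (h : Fin N → ℝ) (s : Fin N) :
    ∑ s', p.gen s s' * (h s' - h s) = p.gen.mulVec h s := by
  simp_rw [mul_sub, Finset.sum_sub_distrib, ← Finset.sum_mul, p.isGenerator.row_sum s]
  simp [Matrix.mulVec, dotProduct]

/-- The drift of `q ^ 2 / 2 - q * h s` when `h` solves the Poisson equation with mean rate `c`. -/
noncomputable def quadraticDrift (c : ℝ) (h : Fin N → ℝ) (s : Fin N) (q : ℕ) : ℝ :=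
  -(c - S.lam i) * q + q * (p.rate i s - p.departureRate i s q)
    + (S.lam i + p.departureRate i s q) / 2 - (S.lam i - p.departureRate i s q) * h s

/-- The function `q ^ 2 / 2 - q * h s`, made constant above level `n`. -/
noncomputable def truncatedQuadratic (h : Fin N → ℝ) (n : ℕ) (s : Fin N) (q : ℕ) : ℝ :=
  if q ≤ n then (q : ℝ) ^ 2 / 2 - q * h s else (n : ℝ) ^ 2 / 2

variable {i} {c : ℝ} {h : Fin N → ℝ}

/-- The leading drift of `q ^ 2 / 2` is `q` times arrival minus departure rate. Modulation of `-q h`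
adds `-q (c - r)`, leaving `-(c - λ) q` and `q` times the unused rate. -/
theorem typeGenerator_quadratic (hh : ∀ s, p.gen.mulVec h s = c - p.rate i s) (s : Fin N) (q : ℕ) :
    p.typeGenerator i (fun s q => (q : ℝ) ^ 2 / 2 - q * h s) s q = p.quadraticDrift i c h s q := by
  have h1 : ∑ s', p.gen s s' * (((q : ℝ) ^ 2 / 2 - q * h s') - ((q : ℝ) ^ 2 / 2 - q * h s)) =
      -q * (c - p.rate i s) := by
    rw [← hh, ← sum_gen_mul_sub, Finset.mul_sum]
    exact Finset.sum_congr rfl fun _ _ => by ring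
  rw [typeGenerator, h1, quadraticDrift]
  -- At `q = 0` the truncated subtraction `q - 1 = 0` does no harm, as the departure rate vanishes
  -- there.
  rcases q with _ | q
  · simp [departureRate]
    ring
  · push_cast [Nat.add_sub_cancel]
    ring

/-- Stationarity speaks only of bounded functions, hence the truncation. Jumps change `q` by at most
one, so it is felt only at level `n` (through arrivals) and `n + 1` (through departures), with
errors linear in `n`; above that the function is constant. -/
theorem typeGenerator_truncatedQuadratic_of_lt (hh : ∀ s, p.gen.mulVec h s = c - p.rate i s)
    {n q : ℕ} (hq : q < n) (s : Fin N) :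
    p.typeGenerator i (truncatedQuadratic h n) s q = p.quadraticDrift i c h s q := by
  rw [← p.typeGenerator_quadratic hh]
  simp only [typeGenerator, truncatedQuadratic, if_pos hq.le, if_pos (Nat.succ_le_of_lt hq),
    if_pos ((Nat.sub_le q 1).trans hq.le)]

theorem typeGenerator_truncatedQuadratic_self (hh : ∀ s, p.gen.mulVec h s = c - p.rate i s)
    (n : ℕ) (s : Fin N) :
    p.typeGenerator i (truncatedQuadratic h n) s n = p.quadraticDrift i c h s n
      - S.lam i * (n + 1 / 2 - h s) + S.lam i * n * h s := by
  rw [← p.typeGenerator_quadratic hh]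
  simp only [typeGenerator, truncatedQuadratic, le_refl, if_true, if_neg (Nat.not_succ_le_self n),
    if_pos (Nat.sub_le n 1)]
  push_cast
  ring

theorem typeGenerator_truncatedQuadratic_succ (n : ℕ) (s : Fin N) :
    p.typeGenerator i (truncatedQuadratic h n) s (n + 1) =
      -p.departureRate i s (n + 1) * n * h s := by
  simp only [typeGenerator, truncatedQuadratic, if_neg (Nat.not_succ_le_self n),
    if_neg (show ¬ n + 1 + 1 ≤ n by omega), Nat.add_sub_cancel, le_refl, if_true]
  simp
  ring

theorem typeGenerator_truncatedQuadratic_of_gt {n q : ℕ} (hq : n + 1 < q) (s : Fin N) :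
    p.typeGenerator i (truncatedQuadratic h n) s q = 0 := by
  simp only [typeGenerator, truncatedQuadratic, if_neg (show ¬ q ≤ n by omega),
    if_neg (show ¬ q + 1 ≤ n by omega), if_neg (show ¬ q - 1 ≤ n by omega)]
  simp

theorem exists_truncatedQuadratic_bounded (h : Fin N → ℝ) (n : ℕ) :
    ∃ C, ∀ s q, |truncatedQuadratic h n s q| ≤ C := by
  obtain ⟨H, hH⟩ := (Set.finite_range fun s => |h s|).bddAbove
  have hH' : ∀ s, |h s| ≤ H := fun s => hH ⟨s, rfl⟩
  refine ⟨(n : ℝ) ^ 2 / 2 + n * H, fun s q => ?_⟩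
  have hH0 := (abs_nonneg _).trans (hH' s)
  unfold truncatedQuadratic
  split_ifs with hq
  · have hq' : (q : ℝ) ≤ n := by exact_mod_cast hq
    refine (abs_sub _ _).trans ?_
    rw [abs_mul, Nat.abs_cast, abs_of_nonneg (by positivity)]
    have := hH' s
    gcongr
  · rw [abs_of_nonneg (by positivity)]
    nlinarith [Nat.cast_nonneg (α := ℝ) n]

/-- The Lyapunov bounds on the truncated quadratic. -/
theorem exists_truncatedQuadratic_drift_bound (hh : ∀ s, p.gen.mulVec h s = c - p.rate i s)
    (hc : S.lam i < c) :
    ∃ C, 0 ≤ C ∧ ∀ n s q,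
      |p.typeGenerator i (truncatedQuadratic h n) s q| ≤ C * (q + 1) ∧
      p.typeGenerator i (truncatedQuadratic h n) s q ≤
        C - (c - S.lam i) * (if q ≤ n then (q : ℝ) else 0)
          + C * (if n ≤ q ∧ q ≤ n + 1 then (q : ℝ) else 0) := by
  obtain ⟨H, hH⟩ := (Set.finite_range fun s => |h s|).bddAbove
  have hH' : ∀ s, |h s| ≤ H := fun s => hH ⟨s, rfl⟩
  set l := S.lam i
  have hl : 0 ≤ l := S.lam_nonneg i
  set B := S.mu i * p.maxServed i
  have hB : 0 ≤ B := mul_nonneg (S.mu_pos i).le (Nat.cast_nonneg _)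
  set b : ℝ := (p.maxServed i : ℝ)
  have hb : 0 ≤ b := Nat.cast_nonneg _
  -- One summand for each part of the drift other than `-(c - l) q`: the unused rate times `q` (at
  -- most `b` whenever it is nonzero), the second-order term, and the corrector.
  set C₀ := b * B + (l + B) / 2 + (l + B) * |H|
  have hC₀ : 0 ≤ C₀ := by positivity
  have hdrift : ∀ s q, |p.quadraticDrift i c h s q + (c - l) * q| ≤ C₀ := by
    intro s q
    have hd0 := p.departureRate_nonneg i s q
    have hdr := p.departureRate_le_rate i s q
    have hr := p.rate_le i s
    have hw := p.mul_rate_sub_departureRate_le i s q 0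
    rw [sub_zero, sub_zero] at hw
    have hhs := (hH' s).trans (le_abs_self H)
    set d := p.departureRate i s q
    have h1 : |(l - d) * h s| ≤ (l + B) * |H| := by
      rw [abs_mul]
      exact mul_le_mul (abs_le.2 ⟨by linarith, by linarith⟩) hhs (abs_nonneg _) (by positivity)
    have h2 : b * (p.rate i s - d) ≤ b * B := mul_le_mul_of_nonneg_left (by linarith) hb
    have h3 : 0 ≤ (q : ℝ) * (p.rate i s - d) := mul_nonneg (Nat.cast_nonneg _) (by linarith)
    rw [abs_le] at h1 ⊢
    have : p.quadraticDrift i c h s q + (c - l) * q =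
      q * (p.rate i s - d) + (l + d) / 2 - (l - d) * h s := by
      simp only [quadraticDrift]; ring
    rw [this]
    have : 0 ≤ b * B := by positivity
    constructor <;> simp only [C₀] <;> linarith
  have hlh : ∀ s, |l * h s| ≤ l * |H| := fun s => by
    rw [abs_mul, abs_of_nonneg hl]
    exact mul_le_mul_of_nonneg_left ((hH' s).trans (le_abs_self H)) hl
  -- The summands absorb, in turn, the linear drift, its bounded remainder, the arrival error at
  -- level `n` and the departure error at level `n + 1`.
  set C := (c - l) + C₀ + l * (1 + |H|) + B * |H|
  have hcl : 0 < c - l := sub_pos.2 hc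
  have hlH : 0 ≤ l * |H| := by positivity
  have hBH : 0 ≤ B * |H| := by positivity
  have hC : 0 ≤ C := by positivity
  refine ⟨C, hC, fun n s q => ?_⟩
  have hq0 : (0 : ℝ) ≤ q := Nat.cast_nonneg q
  have e1 : C * ((q : ℝ) + 1) =
    (c - l) * q + (c - l) + C₀ * q + C₀ + l * q + l + l * |H| * q + l * |H|
      + B * |H| * q + B * |H| := by
    simp only [C]; ring
  have p1 : 0 ≤ C₀ * q := by positivity
  have p2 : 0 ≤ l * q := by positivity
  have p3 : 0 ≤ l * |H| * q := by positivity
  have p4 : 0 ≤ B * |H| * q := by positivity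
  have p5 : 0 ≤ (c - l) * q := by positivity
  have hD := abs_le.1 (hdrift s q)
  have hL := abs_le.1 (hlh s)
  rcases lt_trichotomy q n with hq | rfl | hq
  · rw [p.typeGenerator_truncatedQuadratic_of_lt hh hq, if_pos hq.le,
      if_neg (by omega), mul_zero, add_zero]
    refine ⟨abs_le.2 ⟨by linarith, by linarith⟩, ?_⟩
    simp only [C]
    linarith
  · have hLq : |l * h s * q| ≤ l * |H| * q := by
      rw [abs_mul, abs_of_nonneg hq0]
      exact mul_le_mul_of_nonneg_right (hlh s) hq0
    have hLq' := abs_le.1 hLq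
    rw [p.typeGenerator_truncatedQuadratic_self hh, if_pos le_rfl, if_pos ⟨le_rfl, by omega⟩]
    refine ⟨abs_le.2 ⟨by linarith, by linarith⟩, ?_⟩
    linarith
  · rcases eq_or_lt_of_le (Nat.succ_le_of_lt hq) with rfl | hq'
    · rw [Nat.succ_eq_add_one, p.typeGenerator_truncatedQuadratic_succ, if_neg (by omega),
        if_pos ⟨by omega, le_rfl⟩, mul_zero, sub_zero]
      have hbd : |-p.departureRate i s (n + 1) * n * h s| ≤ B * |H| * (n + 1 : ℕ) := by
        rw [abs_mul, abs_mul, abs_neg, abs_of_nonneg (p.departureRate_nonneg i s _), Nat.abs_cast]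
        calc _ ≤ B * ((n + 1 : ℕ) : ℝ) * |H| := by
              refine mul_le_mul (mul_le_mul ((p.departureRate_le_rate i s _).trans (p.rate_le i s))
                (by push_cast; linarith) (Nat.cast_nonneg _) hB)
                ((hH' s).trans (le_abs_self H)) (abs_nonneg _) (by positivity)
          _ = _ := by ring
      rw [Nat.succ_eq_add_one] at e1 p1 p2 p3 p4 p5
      refine ⟨hbd.trans (by linarith), (le_abs_self _).trans (hbd.trans (by linarith))⟩
    · rw [p.typeGenerator_truncatedQuadratic_of_gt hq', if_neg (by omega), if_neg (by omega)]
      refine ⟨by rw [abs_zero]; positivity, by simpa using hC⟩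

end PMSRPolicy

/-! ### A Foster-type integrability criterion with a boundary term. -/

section

open MeasureTheory Filter Topology

variable {Ω : Type*} [MeasurableSpace Ω] {μ : Measure Ω} [IsFiniteMeasure μ] {q : Ω → ℕ}

theorem integrable_ite_natCast_of_le (hq : Measurable q) (A : ℕ → Prop) [DecidablePred A] (n : ℕ)
    (hA : ∀ k, A k → k ≤ n) : Integrable (fun x => if A (q x) then (q x : ℝ) else 0) μ := by
  refine Integrable.of_bound (C := n)
    ((Measurable.of_discrete (f := fun k : ℕ => if A k then (k : ℝ) else 0)).comp
      hq).aestronglyMeasurable (ae_of_all _ fun x => ?_)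
  change ‖if A (q x) then (q x : ℝ) else 0‖ ≤ n
  split_ifs with h
  · rw [Real.norm_natCast]; exact_mod_cast hA _ h
  · simp

/-- Otherwise `(n + 1)` times the mass of levels `n` and `n + 1` exceeds `1` for all large `n`, and
these summable masses would dominate the harmonic series. No moment of `q` is needed. -/
theorem frequently_integral_two_levels_le_one (hq : Measurable q) :
    ∃ᶠ n : ℕ in atTop, ∫ x, (if n ≤ q x ∧ q x ≤ n + 1 then (q x : ℝ) else 0) ∂μ ≤ 1 := by
  by_contra hfreq
  have hev := not_frequently.1 hfreq
  have hm : ∀ n, MeasurableSet (q ⁻¹' {n}) := fun n => hq (measurableSet_singleton n)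
  have hs : Summable fun n => μ.real (q ⁻¹' {n}) := summable_measure_toReal hm
    fun a b hab => Disjoint.preimage q (by simpa using hab)
  have hle : ∀ n : ℕ, ∫ x, (if n ≤ q x ∧ q x ≤ n + 1 then (q x : ℝ) else 0) ∂μ ≤
      (n + 1) * (μ.real (q ⁻¹' {n}) + μ.real (q ⁻¹' {n + 1})) := fun n => by
    have hone : ∀ m : ℕ, (q ⁻¹' {m}).indicator (1 : Ω → ℝ) = fun x => if q x = m then 1 else 0 :=
      fun m => funext fun x => by
        by_cases hx : q x = m <;> simp [hx]
    have hi : ∀ m : ℕ, Integrable (fun x => if q x = m then (1 : ℝ) else 0) μ := fun m =>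
      hone m ▸ (integrable_const (1 : ℝ)).indicator (hm m)
    rw [← integral_indicator_one (hm n), ← integral_indicator_one (hm (n + 1)), hone, hone,
      ← integral_add (hi n) (hi (n + 1)), ← integral_const_mul]
    refine integral_mono (integrable_ite_natCast_of_le hq (fun k => n ≤ k ∧ k ≤ n + 1) (n + 1)
      fun k h => h.2) (((hi n).add (hi (n + 1))).const_mul _) fun x => ?_
    change (if n ≤ q x ∧ q x ≤ n + 1 then (q x : ℝ) else 0) ≤
      (n + 1) * ((if q x = n then 1 else 0) + if q x = n + 1 then 1 else 0)
    by_cases h1 : q x = n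
    · simp [h1]
    · by_cases h2 : q x = n + 1
      · simp [h2]
      · rw [if_neg (by omega), if_neg h1, if_neg h2]; simp
  have hs2 : Summable fun n => μ.real (q ⁻¹' {n}) + μ.real (q ⁻¹' {n + 1}) :=
    hs.add (hs.comp_injective (add_left_injective 1))
  have hO : (fun n : ℕ => 1 / ((n + 1 : ℕ) : ℝ)) =O[atTop]
      fun n => μ.real (q ⁻¹' {n}) + μ.real (q ⁻¹' {n + 1}) := by
    refine Asymptotics.IsBigO.of_bound 1 ?_
    filter_upwards [hev] with n hn
    have h1 := (not_le.1 hn).trans_le (hle n)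
    have h2 : (0 : ℝ) < n + 1 := by positivity
    rw [one_mul, Real.norm_of_nonneg (by positivity), Real.norm_of_nonneg (by positivity)]
    push_cast
    rw [div_le_iff₀ h2]
    linarith
  have hs3 : Summable fun n : ℕ => 1 / ((n + 1 : ℕ) : ℝ) := summable_of_isBigO_nat hs2 hO
  exact Real.not_summable_one_div_natCast
    ((summable_nat_add_iff (f := fun n : ℕ => 1 / (n : ℝ)) 1).1 hs3)

/-- A Foster-type criterion for the integrability of a level. -/
theorem integrable_natCast_of_truncated_le (hq : Measurable q) {a C : ℝ} (ha : 0 < a) (hC : 0 ≤ C)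
    (h : ∀ n : ℕ, a * ∫ x, (if q x ≤ n then (q x : ℝ) else 0) ∂μ ≤
      C + C * ∫ x, (if n ≤ q x ∧ q x ≤ n + 1 then (q x : ℝ) else 0) ∂μ) :
    Integrable (fun x => (q x : ℝ)) μ := by
  have hm : ∀ n, MeasurableSet {x | q x ≤ n} := fun n => hq measurableSet_Iic
  have hind : ∀ n, ∫ x, (if q x ≤ n then (q x : ℝ) else 0) ∂μ =
      ∫ x in {x | q x ≤ n}, (q x : ℝ) ∂μ := fun n => by
    rw [← integral_indicator (hm n)]; simp [Set.indicator_apply]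
  have hcover : AECover μ atTop fun n : ℕ => {x | q x ≤ n} :=
    ⟨ae_of_all _ fun x => eventually_ge_atTop (q x), hm⟩
  -- The truncated means increase with the level, so each is bounded by the one at some `m ≥ n`
  -- whose boundary term is at most `1`.
  have hbound : ∀ n : ℕ, ∫ x, (if q x ≤ n then (q x : ℝ) else 0) ∂μ ≤ 2 * C / a := fun n => by
    obtain ⟨m, hm1, hnm⟩ :=
      ((frequently_integral_two_levels_le_one (μ := μ) hq).and_eventually
        (eventually_ge_atTop n)).exists
    refine le_trans (integral_mono (integrable_ite_natCast_of_le hq (· ≤ n) n fun _ h => h)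
      (integrable_ite_natCast_of_le hq (· ≤ m) m fun _ h => h) fun x => ?_)
      ((le_div_iff₀' ha).2 ((h m).trans (by nlinarith)))
    dsimp only
    split_ifs with h1 h2
    · exact le_rfl
    · omega
    · positivity
    · exact le_rfl
  refine hcover.integrable_of_integral_bounded_of_nonneg_ae (2 * C / a) (fun n => ?_)
    (ae_of_all _ fun x => Nat.cast_nonneg _) (.of_forall fun n => (hind n).symm.trans_le (hbound n))
  rw [← integrable_indicator_iff (hm n)]
  refine (integrable_ite_natCast_of_le (μ := μ) hq (· ≤ n) n fun _ h => h).congr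
    (ae_of_all _ fun x => ?_)
  simp [Set.indicator_apply]

end

/-! ### Steady-state identities and the mean queue length bound. -/

namespace PMSRPolicy

open MeasureTheory Filter Topology

variable {K R N : ℕ} {S : MultiresourceSystem K R} {p : PMSRPolicy S N} {i : Fin K}
  {P : Measure (Fin N × (Fin K → ℕ))}

namespace IsSteadyState

variable (hP : p.IsSteadyState P)
include hP

theorem integral_typeGenerator_eq_zero {g : Fin N → ℕ → ℝ} {C : ℝ} (hg : ∀ s q, |g s q| ≤ C) :
    ∫ x, p.typeGenerator i g x.1 (x.2 i) ∂P = 0 := by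
  simp_rw [← p.queueGenerator_comp i g]
  exact hP.stationary _ ⟨C, fun x => hg _ _⟩

/-- Arrivals and departures do not affect a function of the modulating state. With `h` a Poisson
solution this identifies stationary means. -/
theorem integral_gen_mulVec_eq_zero (h : Fin N → ℝ) : ∫ x, p.gen.mulVec h x.1 ∂P = 0 := by
  obtain ⟨C, hC⟩ := (Set.finite_range fun s => |h s|).bddAbove
  rw [← hP.stationary (fun x => h x.1) ⟨C, fun x => hC ⟨x.1, rfl⟩⟩]
  refine integral_congr_ae (ae_of_all _ fun x => ?_)
  simp [queueGenerator, sum_gen_mul_sub]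

theorem integrable_modulator (f : Fin N → ℝ) : Integrable (fun x => f x.1) P := by
  have := hP.isProbability
  obtain ⟨C, hC⟩ := (Set.finite_range fun s => |f s|).bddAbove
  exact Integrable.of_bound (C := C) Measurable.of_discrete.aestronglyMeasurable
    (ae_of_all _ fun x => hC ⟨x.1, rfl⟩)

/-- The truncated quadratic has mean drift zero, so integrating its Lyapunov bound yields exactly
the hypothesis of `integrable_natCast_of_truncated_le`. -/
theorem integrable_queueLength {c : ℝ} {h : Fin N → ℝ}
    (hh : ∀ s, p.gen.mulVec h s = c - p.rate i s) (hc : S.lam i < c) :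
    Integrable (fun x => (x.2 i : ℝ)) P := by
  have := hP.isProbability
  have hq : Measurable fun x : Fin N × (Fin K → ℕ) => x.2 i := Measurable.of_discrete
  obtain ⟨C, hC, hb⟩ := p.exists_truncatedQuadratic_drift_bound hh hc
  refine integrable_natCast_of_truncated_le hq (sub_pos.2 hc) hC fun n => ?_
  obtain ⟨B, hB⟩ := exists_truncatedQuadratic_bounded h n
  have h0 := hP.integral_typeGenerator_eq_zero (i := i) hB
  have i1 : Integrable (fun x => (c - S.lam i) * if x.2 i ≤ n then (x.2 i : ℝ) else 0) P :=
    (integrable_ite_natCast_of_le hq (· ≤ n) n fun _ h => h).const_mul _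
  have i2 : Integrable (fun x => C * if n ≤ x.2 i ∧ x.2 i ≤ n + 1 then (x.2 i : ℝ) else 0) P :=
    (integrable_ite_natCast_of_le hq (fun k => n ≤ k ∧ k ≤ n + 1) (n + 1) fun _ h => h.2).const_mul _
  have i0 : Integrable (fun _ : Fin N × (Fin K → ℕ) => C) P := integrable_const C
  have hle : ∫ x, p.typeGenerator i (truncatedQuadratic h n) x.1 (x.2 i) ∂P ≤ _ :=
    integral_mono (?_ : Integrable _ P) ((i0.sub i1).add i2) fun x => (hb n x.1 (x.2 i)).2
  · rw [h0, integral_add' (i0.sub i1) i2, integral_sub' i0 i1, integral_const, integral_const_mul,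
      integral_const_mul, probReal_univ, one_smul] at hle
    linarith
  · refine Integrable.of_bound (C := C * ((n + 1 : ℕ) + 1))
      Measurable.of_discrete.aestronglyMeasurable (ae_of_all _ fun x => ?_)
    rcases le_or_gt (x.2 i) (n + 1) with hx | hx
    · refine (hb n x.1 (x.2 i)).1.trans (mul_le_mul_of_nonneg_left ?_ hC)
      exact_mod_cast Nat.succ_le_succ hx
    · rw [p.typeGenerator_truncatedQuadratic_of_gt hx, norm_zero]
      positivity

theorem integrable_quadraticDrift {c : ℝ} {h : Fin N → ℝ}
    (hh : ∀ s, p.gen.mulVec h s = c - p.rate i s) (hc : S.lam i < c) :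
    Integrable (fun x => p.quadraticDrift i c h x.1 (x.2 i)) P := by
  have := hP.isProbability
  obtain ⟨C, hC, hb⟩ := p.exists_truncatedQuadratic_drift_bound hh hc
  refine (((hP.integrable_queueLength hh hc).add (integrable_const 1)).const_mul C).mono'
    Measurable.of_discrete.aestronglyMeasurable (ae_of_all _ fun x => ?_)
  rw [← p.typeGenerator_truncatedQuadratic_of_lt hh (Nat.lt_succ_self (x.2 i))]
  exact (hb _ x.1 (x.2 i)).1

/-- The identity `E[L (q ^ 2 / 2 - q h)] = 0`. -/
theorem integral_quadraticDrift {c : ℝ} {h : Fin N → ℝ}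
    (hh : ∀ s, p.gen.mulVec h s = c - p.rate i s) (hc : S.lam i < c) :
    ∫ x, p.quadraticDrift i c h x.1 (x.2 i) ∂P = 0 := by
  have := hP.isProbability
  obtain ⟨C, hC, hb⟩ := p.exists_truncatedQuadratic_drift_bound hh hc
  -- The drifts of the truncations are dominated by `C * (q + 1)`, integrable because the mean queue
  -- length is already known to be finite.
  have hlim := tendsto_integral_of_dominated_convergence (μ := P)
    (F := fun n x => p.typeGenerator i (truncatedQuadratic h n) x.1 (x.2 i))
    (f := fun x => p.quadraticDrift i c h x.1 (x.2 i))
    (fun x => C * ((x.2 i : ℝ) + 1)) (fun n => Measurable.of_discrete.aestronglyMeasurable)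
    (((hP.integrable_queueLength hh hc).add (integrable_const 1)).const_mul C)
    (fun n => ae_of_all _ fun x => (hb n x.1 (x.2 i)).1)
    (ae_of_all _ fun x => tendsto_const_nhds.congr' (by
      filter_upwards [eventually_gt_atTop (x.2 i)] with n hn
      rw [p.typeGenerator_truncatedQuadratic_of_lt hh hn]))
  refine tendsto_nhds_unique hlim (tendsto_const_nhds.congr fun n => ?_)
  obtain ⟨B, hB⟩ := exists_truncatedQuadratic_bounded h n
  exact (hP.integral_typeGenerator_eq_zero hB).symm

theorem integrable_departureRate : Integrable (fun x => p.departureRate i x.1 (x.2 i)) P := by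
  have := hP.isProbability
  refine Integrable.of_bound (C := S.mu i * p.maxServed i)
    Measurable.of_discrete.aestronglyMeasurable (ae_of_all _ fun x => ?_)
  rw [Real.norm_of_nonneg (p.departureRate_nonneg i _ _)]
  exact (p.departureRate_le_rate i _ _).trans (p.rate_le i _)

/-- In steady state, type-`i` jobs depart at the rate at which they arrive. -/
theorem integral_departureRate : ∫ x, p.departureRate i x.1 (x.2 i) ∂P = S.lam i := by
  have := hP.isProbability
  -- The bounded test function `min q n` replaces `q`: it registers arrivals below `n` and
  -- departures up to `n`, and `n → ∞` recovers the rate balance.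
  have hgen : ∀ n s q, p.typeGenerator i (fun _ q => ((min q n : ℕ) : ℝ)) s q =
      (if q < n then S.lam i else 0) - if q ≤ n then p.departureRate i s q else 0 := by
    intro n s q
    simp only [typeGenerator, sub_self, mul_zero, Finset.sum_const_zero, zero_add]
    rcases lt_trichotomy q n with hq | rfl | hq
    · rw [if_pos hq, if_pos hq.le, min_eq_left hq.le, min_eq_left (Nat.succ_le_of_lt hq),
        min_eq_left ((Nat.sub_le q 1).trans hq.le)]
      rcases q with _ | q
      · simp [departureRate]
      · push_cast [Nat.add_sub_cancel]; ring
    · rw [if_neg (lt_irrefl _), if_pos le_rfl, min_self, min_eq_right (Nat.le_succ q),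
        min_eq_left (Nat.sub_le q 1)]
      rcases q with _ | q
      · simp [departureRate]
      · push_cast [Nat.add_sub_cancel]; ring
    · rw [if_neg (by omega), if_neg (by omega), min_eq_right hq.le, min_eq_right (by omega),
        min_eq_right (by omega)]
      simp
  have hd := hP.integrable_departureRate (i := i)
  have hlim := tendsto_integral_of_dominated_convergence (μ := P)
    (F := fun n x => p.typeGenerator i (fun _ q => ((min q n : ℕ) : ℝ)) x.1 (x.2 i))
    (f := fun x => S.lam i - p.departureRate i x.1 (x.2 i))
    (fun x => S.lam i + p.departureRate i x.1 (x.2 i))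
    (fun n => Measurable.of_discrete.aestronglyMeasurable)
    ((integrable_const _).add hd)
    (fun n => ae_of_all _ fun x => by
      have h1 := p.departureRate_nonneg i x.1 (x.2 i)
      have h2 := S.lam_nonneg i
      rw [hgen, Real.norm_eq_abs, abs_le]
      constructor <;> split_ifs <;> linarith)
    (ae_of_all _ fun x => tendsto_const_nhds.congr' (by
      filter_upwards [eventually_gt_atTop (x.2 i)] with n hn
      rw [hgen, if_pos hn, if_pos hn.le]))
  have h0 := tendsto_nhds_unique hlim (tendsto_const_nhds.congr fun n =>
    (hP.integral_typeGenerator_eq_zero (C := n) fun _ q => by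
      rw [Nat.abs_cast]; exact_mod_cast min_le_right q n).symm)
  rw [integral_sub (integrable_const _) hd, integral_const, probReal_univ, one_smul] at h0
  linarith

/-- The mean queue length bound, in terms of a solution of the Poisson equation. -/
theorem integral_queueLength_le {c b : ℝ} {h : Fin N → ℝ}
    (hh : ∀ s, p.gen.mulVec h s = c - p.rate i s) (hc : S.lam i < c) (hb : ∀ s, b ≤ h s) :
    ∫ x, (x.2 i : ℝ) ∂P ≤
      (S.lam i + ∫ x, p.rate i x.1 * h x.1 ∂P - S.lam i * ∫ x, h x.1 ∂P) / (c - S.lam i)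
        - b + p.maxServed i := by
  have := hP.isProbability
  have hcl : 0 < c - S.lam i := sub_pos.2 hc
  have hq := hP.integrable_queueLength hh hc
  have hd := hP.integrable_departureRate (i := i)
  have hr := hP.integrable_modulator (p.rate i)
  have hrh := hP.integrable_modulator fun s => p.rate i s * h s
  have hhi := hP.integrable_modulator h
  have h0 := hP.integral_quadraticDrift hh hc
  have hrc : ∫ x, p.rate i x.1 ∂P = c := by
    have := hP.integral_gen_mulVec_eq_zero h
    simp_rw [hh] at this
    rw [integral_sub (integrable_const _) hr, integral_const, probReal_univ, one_smul] at this
    linarith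
  have hdl := hP.integral_departureRate (i := i)
  set d := fun x : Fin N × (Fin K → ℕ) => p.departureRate i x.1 (x.2 i)
  -- Solve the drift formula for `(c - λ) q` and write `d h = r h - (r - d) h`; the unused rate then
  -- appears as `(q - h) (r - d)`, at most `(β - b) (r - d)`. Its mean is `(β - b) (c - λ)`, which
  -- gives the terms `β - b` after division.
  have hpt : ∀ x : Fin N × (Fin K → ℕ), (c - S.lam i) * x.2 i ≤
      (p.maxServed i - b) * (p.rate i x.1 - d x) + p.rate i x.1 * h x.1
        + (S.lam i + d x) / 2 - S.lam i * h x.1 - p.quadraticDrift i c h x.1 (x.2 i) := by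
    intro x
    have h1 := p.mul_rate_sub_departureRate_le i x.1 (x.2 i) (h x.1)
    have h2 := mul_le_mul_of_nonneg_right (hb x.1)
      (sub_nonneg.2 (p.departureRate_le_rate i x.1 (x.2 i)))
    simp only [quadraticDrift, d]
    linarith
  have hD := hP.integrable_quadraticDrift hh hc
  have k1 : Integrable (fun x => (p.maxServed i - b) * (p.rate i x.1 - d x)) P :=
    (hr.sub hd).const_mul _
  have k2 : Integrable (fun x => (S.lam i + d x) / 2) P := ((integrable_const _).add hd).div_const 2
  have k3 : Integrable (fun x => S.lam i * h x.1) P := hhi.const_mul _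
  have hle := integral_mono (hq.const_mul _) ((((k1.add hrh).add k2).sub k3).sub hD) hpt
  rw [integral_sub' (((k1.add hrh).add k2).sub k3) hD, integral_sub' ((k1.add hrh).add k2) k3,
    integral_add' (k1.add hrh) k2, integral_add' k1 hrh, integral_const_mul, integral_const_mul,
    integral_const_mul, integral_div, integral_sub hr hd, integral_add (integrable_const _) hd,
    integral_const, probReal_univ, one_smul, hrc, hdl, h0] at hle
  rw [sub_add, le_sub_iff_add_le, le_div_iff₀ hcl]
  linarith

end IsSteadyState

end PMSRPolicy

/-! ### Explicit formulas for two-state chains. -/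

section TwoState

variable {G : Matrix (Fin 2) (Fin 2) ℝ}

namespace IsIrreducibleGenerator

variable (hG : IsIrreducibleGenerator G)
include hG

theorem gen_zero_one_pos : 0 < G 0 1 := by
  rcases (hG.irreducible 0 1).cases_head with h | ⟨b, ⟨hb, hpos⟩, -⟩
  · simp at h
  · fin_cases b
    · simp at hb
    · exact hpos

theorem gen_one_zero_pos : 0 < G 1 0 := by
  rcases (hG.irreducible 1 0).cases_head with h | ⟨b, ⟨hb, hpos⟩, -⟩
  · simp at h
  · fin_cases b
    · exact hpos
    · simp at hb

theorem gen_zero_zero : G 0 0 = -G 0 1 := by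
  have := hG.row_sum 0
  rw [Fin.sum_univ_two] at this
  linarith

theorem gen_one_one : G 1 1 = -G 1 0 := by
  have := hG.row_sum 1
  rw [Fin.sum_univ_two] at this
  linarith

theorem isStationaryDistribution_two_iff (w : Fin 2 → ℝ) :
    IsStationaryDistribution G w ↔
      w = ![G 1 0 / (G 0 1 + G 1 0), G 0 1 / (G 0 1 + G 1 0)] := by
  have h1 := hG.gen_zero_one_pos
  have h2 := hG.gen_one_zero_pos
  have h3 : 0 < G 0 1 + G 1 0 := add_pos h1 h2
  constructor
  · intro hw
    have hs := hw.sum_eq_one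
    have hb := congrFun hw.balance 0
    simp only [Matrix.vecMul, dotProduct, Fin.sum_univ_two, hG.gen_zero_zero, Pi.zero_apply]
      at hs hb
    have e0 : w 0 = G 1 0 / (G 0 1 + G 1 0) := by
      rw [eq_div_iff h3.ne']
      linear_combination G 1 0 * hs - hb
    have e1 : w 1 = G 0 1 / (G 0 1 + G 1 0) := by
      rw [eq_div_iff h3.ne']
      linear_combination G 0 1 * hs + hb
    ext s
    fin_cases s
    · exact e0
    · exact e1
  · rintro rfl
    refine ⟨fun s => ?_, ?_, ?_⟩
    · fin_cases s
      · exact (div_pos h2 h3).le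
      · exact (div_pos h1 h3).le
    · simp only [Fin.sum_univ_two, Matrix.cons_val_zero, Matrix.cons_val_one]
      rw [← add_div, add_comm, div_self h3.ne']
    · ext s
      fin_cases s <;>
        simp [Matrix.vecMul, dotProduct, Fin.sum_univ_two, hG.gen_zero_zero, hG.gen_one_one] <;>
        ring

theorem stationaryDistribution_two :
    stationaryDistribution G = ![G 1 0 / (G 0 1 + G 1 0), G 0 1 / (G 0 1 + G 1 0)] :=
  (hG.isStationaryDistribution_two_iff _).1
    (Classical.epsilon_spec ⟨_, (hG.isStationaryDistribution_two_iff _).2 rfl⟩)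

end IsIrreducibleGenerator

/-- The stationary mean of a function of the state of a two-state chain. -/
noncomputable def twoStateMean (G : Matrix (Fin 2) (Fin 2) ℝ) (f : Fin 2 → ℝ) : ℝ :=
  (G 1 0 * f 0 + G 0 1 * f 1) / (G 0 1 + G 1 0)

/-- The centred solution of the Poisson equation of a two-state chain. -/
noncomputable def twoStatePoisson (G : Matrix (Fin 2) (Fin 2) ℝ) (f : Fin 2 → ℝ) : Fin 2 → ℝ :=
  ![G 0 1 * (f 0 - f 1) / (G 0 1 + G 1 0) ^ 2, G 1 0 * (f 1 - f 0) / (G 0 1 + G 1 0) ^ 2]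

theorem twoStateMean_twoStatePoisson (G : Matrix (Fin 2) (Fin 2) ℝ) (f : Fin 2 → ℝ) :
    twoStateMean G (twoStatePoisson G f) = 0 := by
  simp [twoStatePoisson, twoStateMean]
  left
  ring

theorem iInf_twoStatePoisson (G : Matrix (Fin 2) (Fin 2) ℝ) (f : Fin 2 → ℝ) :
    ⨅ s, twoStatePoisson G f s =
      -(max (G 1 0 * (f 0 - f 1)) (G 0 1 * (f 1 - f 0)) / (G 0 1 + G 1 0) ^ 2) := by
  have h3 : 0 ≤ (G 0 1 + G 1 0) ^ 2 := sq_nonneg _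
  have h0 : twoStatePoisson G f 0 = -(G 0 1 * (f 1 - f 0) / (G 0 1 + G 1 0) ^ 2) := by
    simp [twoStatePoisson]; ring
  have h1 : twoStatePoisson G f 1 = -(G 1 0 * (f 0 - f 1) / (G 0 1 + G 1 0) ^ 2) := by
    simp [twoStatePoisson]; ring
  rw [← max_div_div_right h3, ← min_neg_neg, ← h0, ← h1]
  refine le_antisymm (le_min (ciInf_le (Set.finite_range _).bddBelow 1)
    (ciInf_le (Set.finite_range _).bddBelow 0)) (le_ciInf fun s => ?_)
  fin_cases s
  · exact min_le_right _ _
  · exact min_le_left _ _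

namespace IsIrreducibleGenerator

variable (hG : IsIrreducibleGenerator G) (f : Fin 2 → ℝ)
include hG

theorem sum_stationaryDistribution_mul :
    ∑ s, stationaryDistribution G s * f s = twoStateMean G f := by
  rw [hG.stationaryDistribution_two, Fin.sum_univ_two, twoStateMean]
  simp only [Matrix.cons_val_zero, Matrix.cons_val_one]
  ring

theorem mulVec_twoStatePoisson (s : Fin 2) :
    G.mulVec (twoStatePoisson G f) s = twoStateMean G f - f s := by
  have h3 : G 0 1 + G 1 0 ≠ 0 := (add_pos hG.gen_zero_one_pos hG.gen_one_zero_pos).ne'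
  fin_cases s <;>
    simp [Matrix.mulVec, dotProduct, Fin.sum_univ_two, hG.gen_zero_zero, hG.gen_one_one,
      twoStatePoisson, twoStateMean] <;> field_simp <;> ring

/-- A two-state generator has rank one, and its image consists of the centred functions scaled by
its only nonzero eigenvalue. So the semigroup acts on the Poisson solution by a scalar exponential.
-/
theorem mulVec_twoStatePoisson_eq_smul :
    G.mulVec (twoStatePoisson G f) = (-(G 0 1 + G 1 0)) • twoStatePoisson G f := by
  have h3 : G 0 1 + G 1 0 ≠ 0 := (add_pos hG.gen_zero_one_pos hG.gen_one_zero_pos).ne'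
  ext s
  rw [hG.mulVec_twoStatePoisson]
  fin_cases s <;> simp [twoStatePoisson, twoStateMean] <;> field_simp <;> ring

theorem twoStateMean_mul_twoStatePoisson :
    twoStateMean G (fun s => f s * twoStatePoisson G f s) =
      G 0 1 * G 1 0 * (f 0 - f 1) ^ 2 / (G 0 1 + G 1 0) ^ 3 := by
  have h3 : G 0 1 + G 1 0 ≠ 0 := (add_pos hG.gen_zero_one_pos hG.gen_one_zero_pos).ne'
  simp [twoStatePoisson, twoStateMean]
  field_simp
  ring

/-- The mean count of a two-state chain converges exponentially fast to its linear asymptote. -/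
theorem tendsto_meanCount_sub (s : Fin 2) :
    Filter.Tendsto (fun t => meanCount G f s t - twoStateMean G f * t) Filter.atTop
      (nhds (twoStatePoisson G f s)) := by
  have h3 := add_pos hG.gen_zero_one_pos hG.gen_one_zero_pos
  have hone : G.mulVec 1 = 0 := by
    ext s
    simpa [Matrix.mulVec, dotProduct] using hG.row_sum s
  have heq : (fun t => meanCount G f s t - twoStateMean G f * t) = fun t =>
      twoStatePoisson G f s - Real.exp (-(G 0 1 + G 1 0) * t) * twoStatePoisson G f s := by
    ext t
    rw [meanCount_eq_of_poisson G f hone (hG.mulVec_twoStatePoisson f),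
      exp_smul_mulVec_of_eigenvector G (hG.mulVec_twoStatePoisson_eq_smul f)]
    simp
    ring
  have hexp : Filter.Tendsto (fun t => Real.exp (-(G 0 1 + G 1 0) * t)) Filter.atTop (nhds 0) :=
    Real.tendsto_exp_atBot.comp (Filter.tendsto_id.const_mul_atTop_of_neg (neg_neg_of_pos h3))
  rw [heq]
  simpa using tendsto_const_nhds.sub (hexp.mul_const (twoStatePoisson G f s))

end IsIrreducibleGenerator

end TwoState

/-! ### Relative completions and queue bounds for two-state policies. -/

namespace PMSRPolicy

open MeasureTheory Filter Topology

variable {K R : ℕ} {S : MultiresourceSystem K R} (p : PMSRPolicy S 2) (i : Fin K)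

theorem meanRate_two : p.meanRate i = twoStateMean p.gen (p.rate i) :=
  p.isGenerator.sum_stationaryDistribution_mul _

theorem tendsto_excessCompletions_two (s : Fin 2) :
    Tendsto (p.excessCompletions i s) atTop (𝓝 (twoStatePoisson p.gen (p.rate i) s)) := by
  unfold excessCompletions
  rw [meanRate_two]
  exact p.isGenerator.tendsto_meanCount_sub (p.rate i) s

theorem relCompletions_two : p.relCompletions i = twoStatePoisson p.gen (p.rate i) :=
  funext fun s => (p.tendsto_excessCompletions_two i s).limUnder_eq

theorem meanRelCompletions_two : p.meanRelCompletions i =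
    p.gen 0 1 * p.gen 1 0 * (p.rate i 0 - p.rate i 1) ^ 2 /
      (p.gen 0 1 + p.gen 1 0) ^ 3 / p.meanRate i := by
  rw [← p.isGenerator.twoStateMean_mul_twoStatePoisson,
    ← p.isGenerator.sum_stationaryDistribution_mul, meanRelCompletions, relCompletions_two,
    Finset.sum_div]
  exact Finset.sum_congr rfl fun s _ => by rw [weightedDistribution]; ring

variable {p} in
-- Every `f` is its mean minus `G` applied to a Poisson solution, and the latter part integrates to
-- zero; the marginal law of the modulating state need not be computed.
theorem IsSteadyState.integral_modulator_two {P : Measure (Fin 2 × (Fin K → ℕ))}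
    (hP : p.IsSteadyState P) (f : Fin 2 → ℝ) : ∫ x, f x.1 ∂P = twoStateMean p.gen f := by
  have := hP.isProbability
  have h := hP.integral_gen_mulVec_eq_zero (twoStatePoisson p.gen f)
  simp_rw [p.isGenerator.mulVec_twoStatePoisson f] at h
  rw [integral_sub (integrable_const _) (hP.integrable_modulator f), integral_const,
    probReal_univ, one_smul] at h
  linarith

theorem queueUpperBound_two : p.queueUpperBound i =
    p.load i / (1 - p.load i)
      + p.gen 0 1 * p.gen 1 0 * (p.rate i 0 - p.rate i 1) ^ 2 /
          (p.meanRate i * (1 - p.load i) * (p.gen 0 1 + p.gen 1 0) ^ 3)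
      + max (p.gen 1 0 * (p.rate i 0 - p.rate i 1)) (p.gen 0 1 * (p.rate i 1 - p.rate i 0)) /
          (p.gen 0 1 + p.gen 1 0) ^ 2
      + (p.maxServed i : ℝ) := by
  rw [queueUpperBound, relCompletions_two, iInf_twoStatePoisson,
    meanRelCompletions_two, sub_neg_eq_add, add_div]
  congr 3
  rw [div_div, div_div]
  ring

variable {i} (hi : S.lam i < p.meanRate i)
include hi

theorem meanRate_pos : 0 < p.meanRate i := (S.lam_nonneg i).trans_lt hi

theorem load_lt_one : p.load i < 1 := (div_lt_one (p.meanRate_pos hi)).2 hi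

variable {p} in
theorem IsSteadyState.integral_queueLength_le_queueUpperBound
    {P : Measure (Fin 2 × (Fin K → ℕ))} (hP : p.IsSteadyState P) :
    Integrable (fun x => (x.2 i : ℝ)) P ∧ ∫ x, (x.2 i : ℝ) ∂P ≤ p.queueUpperBound i := by
  have hh : ∀ s, p.gen.mulVec (twoStatePoisson p.gen (p.rate i)) s = p.meanRate i - p.rate i s :=
    fun s => by rw [p.isGenerator.mulVec_twoStatePoisson, meanRate_two]
  refine ⟨hP.integrable_queueLength hh hi, (hP.integral_queueLength_le hh hi fun s =>
    ciInf_le (Set.finite_range _).bddBelow s).trans_eq ?_⟩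
  have hc := p.meanRate_pos hi
  have hcl : p.meanRate i - S.lam i ≠ 0 := (sub_pos.2 hi).ne'
  rw [hP.integral_modulator_two, hP.integral_modulator_two fun s => _ * _,
    twoStateMean_twoStatePoisson, p.isGenerator.twoStateMean_mul_twoStatePoisson,
    queueUpperBound, relCompletions_two, meanRelCompletions_two, load]
  -- The Poisson solution is centred, so the term with `E[h]` has dropped out; dividing numerator
  -- and denominator by the mean rate gives the form in terms of the load.
  congr 2
  rw [mul_zero, sub_zero, ← add_div, one_sub_div hc.ne', div_div_div_cancel_right₀ hc.ne']

end PMSRPolicy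

/-! ### Functions of the form `a + b / α`. -/

section InverseScale

open Filter Topology

variable {a b : ℝ}

theorem antitone_add_div_Ioi (hb : 0 ≤ b) :
    Antitone fun α : Set.Ioi (0 : ℝ) => a + b / (α : ℝ) := fun α _ h =>
  add_le_add_right (div_le_div_of_nonneg_left hb α.2 h) a

theorem strictAnti_add_div_Ioi (hb : 0 < b) :
    StrictAnti fun α : Set.Ioi (0 : ℝ) => a + b / (α : ℝ) := fun α _ h =>
  add_lt_add_right (div_lt_div_of_pos_left hb α.2 h) a

theorem tendsto_add_div_Ioi (a b : ℝ) :
    Tendsto (fun α : Set.Ioi (0 : ℝ) => a + b / (α : ℝ)) atTop (𝓝 a) := by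
  have h : Tendsto (fun x : ℝ => a + b / x) atTop (𝓝 (a + 0)) :=
    tendsto_const_nhds.add (tendsto_const_nhds.div_atTop tendsto_id)
  rw [add_zero] at h
  exact tendsto_comp_val_Ioi_atTop.2 h

theorem isGLB_add_div_Ioi (hb : 0 ≤ b) :
    IsGLB (Set.range fun α : Set.Ioi (0 : ℝ) => a + b / (α : ℝ)) a :=
  isGLB_of_tendsto_atTop (antitone_add_div_Ioi hb) (tendsto_add_div_Ioi a b)

end InverseScale

/-! ### Arrival-weighted averages. -/

namespace MultiresourceSystem

variable {K R : ℕ} {S : MultiresourceSystem K R}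

theorem average_mono (hΛ : 0 < S.totalRate) {v w : Fin K → ℝ} (h : ∀ i, v i ≤ w i) :
    S.average v ≤ S.average w :=
  mul_le_mul_of_nonneg_left
    (Finset.sum_le_sum fun i _ => mul_le_mul_of_nonneg_left (h i) (S.lam_nonneg i))
    (one_div_pos.2 hΛ).le

theorem average_add_div (v w : Fin K → ℝ) (α : ℝ) :
    S.average (fun i => v i + w i / α) = S.average v + S.average w / α := by
  simp only [average, mul_add, Finset.sum_add_distrib, mul_div_assoc, Finset.sum_div]

theorem average_nonneg (hΛ : 0 < S.totalRate) {v : Fin K → ℝ} (h : ∀ i, 0 ≤ v i) :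
    0 ≤ S.average v :=
  mul_nonneg (one_div_pos.2 hΛ).le
    (Finset.sum_nonneg fun i _ => mul_nonneg (S.lam_nonneg i) (h i))

theorem average_pos (hΛ : 0 < S.totalRate) {v : Fin K → ℝ} (h : ∀ i, 0 ≤ v i) {i : Fin K}
    (hl : 0 < S.lam i) (hi : 0 < v i) : 0 < S.average v :=
  mul_pos (one_div_pos.2 hΛ) (Finset.sum_pos'
    (fun j _ => mul_nonneg (S.lam_nonneg j) (h j)) ⟨i, Finset.mem_univ i, mul_pos hl hi⟩)

end MultiresourceSystem

/-! ### Dependence on the switching rate. -/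

namespace PMSRPolicy

variable {K R : ℕ} {S : MultiresourceSystem K R} (p : PMSRPolicy S 2) (i : Fin K)

theorem twoStateMean_scale (α : Set.Ioi (0 : ℝ)) (f : Fin 2 → ℝ) :
    twoStateMean (p.scale α).gen f = twoStateMean p.gen f := by
  have hα : (α : ℝ) ≠ 0 := (Set.mem_Ioi.1 α.2).ne'
  simp only [twoStateMean, scale, Matrix.smul_apply, smul_eq_mul]
  rw [← mul_add, mul_assoc, mul_assoc, ← mul_add, mul_div_mul_left _ _ hα]

theorem meanRate_scale (α : Set.Ioi (0 : ℝ)) : (p.scale α).meanRate i = p.meanRate i := by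
  rw [meanRate_two, meanRate_two, twoStateMean_scale]
  rfl

theorem load_scale (α : Set.Ioi (0 : ℝ)) : (p.scale α).load i = p.load i := by
  rw [load, load, meanRate_scale]

/-- The part of the queue length bound that is inversely proportional to the switching rate. -/
noncomputable def modulationPenalty : ℝ :=
  p.gen 0 1 * p.gen 1 0 * (p.rate i 0 - p.rate i 1) ^ 2 /
      (p.meanRate i * (1 - p.load i) * (p.gen 0 1 + p.gen 1 0) ^ 3)
    + max (p.gen 1 0 * (p.rate i 0 - p.rate i 1)) (p.gen 0 1 * (p.rate i 1 - p.rate i 0)) /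
      (p.gen 0 1 + p.gen 1 0) ^ 2

/-- Homogeneity in the generator: the variance-like term scales as `α ^ 2 / α ^ 3`, the minimum term
as `α / α ^ 2`, and nothing else depends on `α`. -/
theorem queueUpperBound_scale (α : Set.Ioi (0 : ℝ)) : (p.scale α).queueUpperBound i =
    p.load i / (1 - p.load i) + (p.maxServed i : ℝ) + p.modulationPenalty i / α := by
  have hα : (0 : ℝ) < α := α.2
  rw [queueUpperBound_two, meanRate_scale, load_scale, modulationPenalty]
  have hr : (p.scale α).rate i = p.rate i := rfl
  have hm : (p.scale α).maxServed i = p.maxServed i := rfl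
  have hg : ∀ s s', (p.scale α).gen s s' = α * p.gen s s' := fun s s' => rfl
  rw [hr, hm, hg, hg, mul_assoc (α : ℝ) (p.gen 1 0) (_ - _), mul_assoc (α : ℝ) (p.gen 0 1) (_ - _),
    ← mul_max_of_nonneg _ _ hα.le]
  generalize p.meanRate i * (1 - p.load i) = m
  generalize max (_ : ℝ) _ = M
  rw [← mul_add, mul_pow, mul_pow]
  have e1 : (α : ℝ) * p.gen 0 1 * (α * p.gen 1 0) * (p.rate i 0 - p.rate i 1) ^ 2 /
      (m * (α ^ 3 * (p.gen 0 1 + p.gen 1 0) ^ 3)) =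
      p.gen 0 1 * p.gen 1 0 * (p.rate i 0 - p.rate i 1) ^ 2 /
        (m * (p.gen 0 1 + p.gen 1 0) ^ 3) / α := by
    rw [div_div]
    refine Eq.trans ?_ (mul_div_mul_left _ _ (pow_ne_zero 2 hα.ne'))
    congr 1 <;> ring
  have e2 : (α : ℝ) * M / (α ^ 2 * (p.gen 0 1 + p.gen 1 0) ^ 2) =
      M / (p.gen 0 1 + p.gen 1 0) ^ 2 / α := by
    field_simp
  rw [e1, e2]
  ring

theorem max_rate_diff_nonneg :
    0 ≤ max (p.gen 1 0 * (p.rate i 0 - p.rate i 1)) (p.gen 0 1 * (p.rate i 1 - p.rate i 0)) := by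
  have h1 := p.isGenerator.gen_zero_one_pos
  have h2 := p.isGenerator.gen_one_zero_pos
  rcases le_total (p.rate i 1) (p.rate i 0) with h | h
  · exact le_max_of_le_left (mul_nonneg h2.le (sub_nonneg.2 h))
  · exact le_max_of_le_right (mul_nonneg h1.le (sub_nonneg.2 h))

variable {i} (hi : S.lam i < p.meanRate i)
include hi

theorem modulationPenalty_nonneg : 0 ≤ p.modulationPenalty i := by
  have h1 := p.isGenerator.gen_zero_one_pos
  have h2 := p.isGenerator.gen_one_zero_pos
  have h3 := p.meanRate_pos hi
  have h4 := sub_pos.2 (p.load_lt_one hi)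
  have h5 := p.max_rate_diff_nonneg i
  unfold modulationPenalty
  positivity

theorem modulationPenalty_pos (hs : p.sched 0 i ≠ p.sched 1 i) : 0 < p.modulationPenalty i := by
  have h1 := p.isGenerator.gen_zero_one_pos
  have h2 := p.isGenerator.gen_one_zero_pos
  have h3 := p.meanRate_pos hi
  have h4 := sub_pos.2 (p.load_lt_one hi)
  have h5 := p.max_rate_diff_nonneg i
  -- The squared difference makes the first summand strictly positive; for the maximum,
  -- nonnegativity is enough.
  have hr : p.rate i 0 - p.rate i 1 ≠ 0 := by
    rw [rate, rate, ← mul_sub]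
    exact mul_ne_zero (S.mu_pos i).ne' (sub_ne_zero.2 (by exact_mod_cast hs))
  unfold modulationPenalty
  positivity

end PMSRPolicy

/-! ### The main theorem. -/

theorem mainTheorem10 {K R : ℕ} (S : MultiresourceSystem K R) (p : PMSRPolicy S 2)
    (hΛ : 0 < S.totalRate) (hstable : ∀ i, S.lam i < p.meanRate i)
    (x₁ x₂ : ℝ) (hx₁ : x₁ = p.gen 0 1) (hx₂ : x₂ = p.gen 1 0) :
    -- the stationary distribution, mean completion rate and load do not depend on `α`
    (∀ (α : Set.Ioi (0 : ℝ)) (w : Fin 2 → ℝ), IsStationaryDistribution (p.scale α).gen w ↔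
      w = ![x₂ / (x₁ + x₂), x₁ / (x₁ + x₂)]) ∧
    (∀ (α : Set.Ioi (0 : ℝ)) (i : Fin K),
      (p.scale α).meanRate i = (x₂ * p.rate i 0 + x₁ * p.rate i 1) / (x₁ + x₂) ∧
      (p.scale α).meanRate i = p.meanRate i ∧ (p.scale α).load i = p.load i) ∧
    -- the relative completions exist, with explicit values proportional to `1 / α`
    (∀ (α : Set.Ioi (0 : ℝ)) (i : Fin K),
      Filter.Tendsto ((p.scale α).excessCompletions i 0) Filter.atTop
        (nhds ((p.scale α).relCompletions i 0)) ∧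
      Filter.Tendsto ((p.scale α).excessCompletions i 1) Filter.atTop
        (nhds ((p.scale α).relCompletions i 1)) ∧
      (p.scale α).relCompletions i 0 =
        (1 / (α : ℝ)) * (x₁ * (p.rate i 0 - p.rate i 1) / (x₁ + x₂) ^ 2) ∧
      (p.scale α).relCompletions i 1 =
        (1 / (α : ℝ)) * (x₂ * (p.rate i 1 - p.rate i 0) / (x₁ + x₂) ^ 2)) ∧
    -- the resulting upper bound, explicitly
    (∀ (α : Set.Ioi (0 : ℝ)) (i : Fin K),
      (p.scale α).queueUpperBound i =
        p.load i / (1 - p.load i)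
          + x₁ * x₂ * (p.rate i 0 - p.rate i 1) ^ 2 /
              ((α : ℝ) * p.meanRate i * (1 - p.load i) * (x₁ + x₂) ^ 3)
          + max (x₂ * (p.rate i 0 - p.rate i 1)) (x₁ * (p.rate i 1 - p.rate i 0)) /
              ((α : ℝ) * (x₁ + x₂) ^ 2)
          + (p.maxServed i : ℝ)) ∧
    -- it does bound the steady-state mean queue lengths
    (∀ (α : Set.Ioi (0 : ℝ)) (P : MeasureTheory.Measure (Fin 2 × (Fin K → ℕ))),
      (p.scale α).IsSteadyState P →
        (∀ i, MeasureTheory.Integrable (fun x => (x.2 i : ℝ)) P ∧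
          ∫ x, (x.2 i : ℝ) ∂P ≤ (p.scale α).queueUpperBound i) ∧
        S.average (fun i => ∫ x, (x.2 i : ℝ) ∂P) ≤ (p.scale α).meanQueueUpperBound) ∧
    -- for each job type, it decreases to its infimum as `α → ∞`
    (∀ i : Fin K,
      Antitone (fun α : Set.Ioi (0 : ℝ) => (p.scale α).queueUpperBound i) ∧
      (p.sched 0 i ≠ p.sched 1 i →
        StrictAnti (fun α : Set.Ioi (0 : ℝ) => (p.scale α).queueUpperBound i)) ∧
      Filter.Tendsto (fun α : Set.Ioi (0 : ℝ) => (p.scale α).queueUpperBound i) Filter.atTop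
        (nhds (p.load i / (1 - p.load i) + (p.maxServed i : ℝ))) ∧
      IsGLB (Set.range fun α : Set.Ioi (0 : ℝ) => (p.scale α).queueUpperBound i)
        (p.load i / (1 - p.load i) + (p.maxServed i : ℝ))) ∧
    -- and so does the bound on the overall mean queue length
    Antitone (fun α : Set.Ioi (0 : ℝ) => (p.scale α).meanQueueUpperBound) ∧
    ((∃ i, 0 < S.lam i ∧ p.sched 0 i ≠ p.sched 1 i) →
      StrictAnti (fun α : Set.Ioi (0 : ℝ) => (p.scale α).meanQueueUpperBound)) ∧
    Filter.Tendsto (fun α : Set.Ioi (0 : ℝ) => (p.scale α).meanQueueUpperBound) Filter.atTop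
      (nhds (S.average fun i => p.load i / (1 - p.load i) + (p.maxServed i : ℝ))) ∧
    IsGLB (Set.range fun α : Set.Ioi (0 : ℝ) => (p.scale α).meanQueueUpperBound)
      (S.average fun i => p.load i / (1 - p.load i) + (p.maxServed i : ℝ)) := by
  subst hx₁ hx₂
  have hst : ∀ (α : Set.Ioi (0 : ℝ)) i, S.lam i < (p.scale α).meanRate i := fun α i => by
    rw [p.meanRate_scale]; exact hstable i
  have hg : ∀ (α : Set.Ioi (0 : ℝ)) s s', (p.scale α).gen s s' = α * p.gen s s' :=
    fun α s s' => rfl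
  have hU : ∀ i, (fun α : Set.Ioi (0 : ℝ) => (p.scale α).queueUpperBound i) = fun α : Set.Ioi (0 : ℝ) =>
      p.load i / (1 - p.load i) + (p.maxServed i : ℝ) + p.modulationPenalty i / (α : ℝ) :=
    fun i => funext (p.queueUpperBound_scale i)
  -- Averaging is linear, so the overall bound is again of the form `a + b / α`, and the averaged
  -- penalty is positive as soon as one type with arrivals contributes.
  have hUm : (fun α : Set.Ioi (0 : ℝ) => (p.scale α).meanQueueUpperBound) = fun α : Set.Ioi (0 : ℝ) =>
      S.average (fun i => p.load i / (1 - p.load i) + (p.maxServed i : ℝ)) +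
        S.average p.modulationPenalty / (α : ℝ) := funext fun α => by
    rw [← MultiresourceSystem.average_add_div, PMSRPolicy.meanQueueUpperBound]
    exact congrArg _ (funext fun i => p.queueUpperBound_scale i α)
  have hpen : ∀ i, 0 ≤ p.modulationPenalty i := fun i => p.modulationPenalty_nonneg (hstable i)
  have hpenm := MultiresourceSystem.average_nonneg hΛ hpen
  have hrel : ∀ (α : Set.Ioi (0 : ℝ)) i s,
      Filter.Tendsto ((p.scale α).excessCompletions i s) Filter.atTop
        (nhds ((p.scale α).relCompletions i s)) := fun α i s => by
    rw [PMSRPolicy.relCompletions_two]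
    exact (p.scale α).tendsto_excessCompletions_two i s
  refine ⟨fun α w => ?_, fun α i => ⟨?_, p.meanRate_scale i α, p.load_scale i α⟩,
    fun α i => ⟨hrel α i 0, hrel α i 1, ?_, ?_⟩, fun α i => ?_, fun α P hP => ?_, fun i => ?_, ?_⟩
  · have hα : (α : ℝ) ≠ 0 := (Set.mem_Ioi.1 α.2).ne'
    rw [(p.scale α).isGenerator.isStationaryDistribution_two_iff, hg, hg, ← mul_add,
      mul_div_mul_left _ _ hα, mul_div_mul_left _ _ hα]
  · rw [p.meanRate_scale, p.meanRate_two, twoStateMean]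
  · have hα : (α : ℝ) ≠ 0 := (Set.mem_Ioi.1 α.2).ne'
    rw [PMSRPolicy.relCompletions_two]
    change (α : ℝ) * p.gen 0 1 * (p.rate i 0 - p.rate i 1) /
      (α * p.gen 0 1 + α * p.gen 1 0) ^ 2 = _
    rw [← mul_add, mul_pow]
    field_simp
  · have hα : (α : ℝ) ≠ 0 := (Set.mem_Ioi.1 α.2).ne'
    rw [PMSRPolicy.relCompletions_two]
    change (α : ℝ) * p.gen 1 0 * (p.rate i 1 - p.rate i 0) /
      (α * p.gen 0 1 + α * p.gen 1 0) ^ 2 = _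
    rw [← mul_add, mul_pow]
    field_simp
  · rw [p.queueUpperBound_scale, PMSRPolicy.modulationPenalty, add_div, div_div, div_div]
    ring_nf
  · have hQ := fun i => hP.integral_queueLength_le_queueUpperBound (hst α i)
    exact ⟨hQ, MultiresourceSystem.average_mono hΛ fun i => (hQ i).2⟩
  · rw [hU]
    exact ⟨antitone_add_div_Ioi (hpen i),
      fun hs => strictAnti_add_div_Ioi (p.modulationPenalty_pos (hstable i) hs),
      tendsto_add_div_Ioi _ _, isGLB_add_div_Ioi (hpen i)⟩
  · rw [hUm]
    exact ⟨antitone_add_div_Ioi hpenm,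
      fun ⟨i, hl, hs⟩ => strictAnti_add_div_Ioi (MultiresourceSystem.average_pos hΛ hpen hl
        (p.modulationPenalty_pos (hstable i) hs)),
      tendsto_add_div_Ioi _ _, isGLB_add_div_Ioi hpenm⟩
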